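/- **Setting.** There are $n\ge 1$ bidders and one item. Bidder $i$'s value lies in $[0,1]$ and is drawn independently from an arbitrary probability distribution $D_i$ on $[0,1]$; $D=D_1\times\dots\times D_n$. A dominant strategy truthful auction is a (possibly randomized) measurable single-item auction in which, whatever the other bidders report, truthful reporting is optimal for every bidder and gives nonnegative utility, and whose total revenue is never negative (so the revenue lies in $[0,1]$). $R_D(h)$ is the expected revenue of auction $h$ under $D$, and $\mathrm{OPT}=\sup_h R_D(h)$ over all dominant strategy truthful auctions. For an integer $s$ (the grid width is $1/s$), an auction in $H_{1/s}$ is given by thresholds $0=\theta^i_0\le\theta^i_1\le\dots\le\theta^i_s\le\theta^i_{s+1}=1$ for each bidder $i$. The index of bidder $i$ is the largest $j$ with $v_i\ge\theta^i_j$. The item goes to the bidder with the highest index, ties being broken in favour of the smaller bidder number, and is unsold if all indices are $0$; the winner pays the lowest bid with which he would still win. An ERM rule for $H_{1/s}$ maps each finite sample $T$ of value profiles (with multiplicities) to some $h_T\in H_{1/s}$ of maximal average revenue on $T$, measurably, with tie-breaking such that each threshold $\theta^i_j$, $1\le j\le s$, is either a value of bidder $i$ occurring in $T$ or equal to $1$.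 Its split-sample growth rate is $\hat\tau(m)=\sup_{|S|=m}\bigl|\{h_T: T\subseteq S,\ |T|=\lceil m/2\rceil\}\bigr|$. Below, $S$ is a sample of $m\ge1$ independent draws from $D$. **Claim.** 1. Every auction in $H_{1/s}$ is dominant strategy truthful, and an ERM rule as above exists for all $n$ and $s$. 2. If $s\ge 2$, every such ERM rule satisfies $\hat\tau(m)\le m^{ns}$ and $$\mathbb E_S[R_D(h_S)]\ \ge\ \sup_{h\in H_{1/s}}R_D(h)-\sqrt{\frac{2ns\log(2m)}{m}}\qquad(m\ge 1).$$ 3. If $s\ge1$, then $\sup_{h\in H_{1/s}}R_D(h)\ge \mathrm{OPT}-\frac1s$. 4. Let $\epsilon_m=\left(\frac{2n\log(2m)}{m}\right)^{1/3}$ and $s_m=\lceil 1/\epsilon_m\rceil$. Every such ERM rule for $H_{1/s_m}$ satisfies, for $m\ge 1$, $$\mathbb E_S[R_D(h_S)]\ \ge\ \mathrm{OPT}-2\left(\frac{2n\log(2m)}{m}\right)^{1/3}.$$ 5. For the learner which on $m$ samples runs such an ERM rule for $H_{1/s_m}$, let the sample complexity $m(\epsilon)$ be the least $M$ such that $\mathbb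 E_S[R_D(h_S)]\ge\mathrm{OPT}-\epsilon$ for all $m\ge M$ and all $D$. There is a universal constant $C$ such that, for all $n\ge1$ and $0<\epsilon\le\frac12$, $m(\epsilon)$ exists and $m(\epsilon)\le C\,\frac{n\log(n/\epsilon)}{\epsilon^3}$; and if moreover $\epsilon\le\frac1n$, then $m(\epsilon)\le C\,\frac{n\log(1/\epsilon)}{\epsilon^3}$. In particular $m(\epsilon)=O\!\left(\frac{n\log(1/\epsilon)}{\epsilon^3}\right)$ as $\epsilon\to0$, with a constant that does not depend on $n$. -/

import Mathlib

open MeasureTheory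

noncomputable section

namespace LevelAuctions

/-- Reported (or true) values of `n` bidders for one item, each in `[0,1]`. -/
abbrev Profile (n : ℕ) := Fin n → unitInterval

/-- A (possibly randomized) direct single-item auction: winning probabilities and
(expected) payments as functions of the reported values. -/
structure Auction (n : ℕ) where
  alloc : Profile n → Fin n → ℝ
  pay : Profile n → Fin n → ℝ

/-- Revenue of an auction on a value profile. -/
def Auction.revenue {n : ℕ} (A : Auction n) (v : Profile n) : ℝ := ∑ i, A.pay v i

/-- Dominant strategy truthful single-item auctions: feasible, incentive compatible,
individually rational, with nonnegative revenue.  Individual rationality and feasibility bound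
the revenue by `1`, so that it lies in `[0,1]`. Individual payments may be negative. -/
structure Auction.IsTruthful {n : ℕ} (A : Auction n) : Prop where
  measurable_alloc : ∀ i, Measurable fun v => A.alloc v i
  measurable_pay : ∀ i, Measurable fun v => A.pay v i
  alloc_nonneg : ∀ v i, 0 ≤ A.alloc v i
  alloc_sum_le_one : ∀ v, ∑ i, A.alloc v i ≤ 1
  truthful : ∀ (v : Profile n) (i : Fin n) (b : unitInterval),
    (v i : ℝ) * A.alloc (Function.update v i b) i - A.pay (Function.update v i b) i
      ≤ (v i : ℝ) * A.alloc v i - A.pay v i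
  individually_rational : ∀ v i, 0 ≤ (v i : ℝ) * A.alloc v i - A.pay v i
  revenue_nonneg : ∀ v, 0 ≤ A.revenue v

/-- `R_D(A)`: expected revenue when bidder `i` draws his value independently from `D i`. -/
def expectedRevenue {n : ℕ} (D : Fin n → Measure unitInterval) (A : Auction n) : ℝ :=
  ∫ v, A.revenue v ∂(Measure.pi D)

/-- `OPT`: the supremum of the expected revenue over all dominant strategy truthful auctions. -/
def OPT {n : ℕ} (D : Fin n → Measure unitInterval) : ℝ :=
  ⨆ A : {A : Auction n // A.IsTruthful}, expectedRevenue D A.1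

/-- The thresholds `θ_1 ≤ ⋯ ≤ θ_s` of every bidder; `threshold i j` is `θ_{j+1}` of bidder `i`. -/
@[ext]
structure Thresholds (n s : ℕ) where
  threshold : Fin n → Fin s → unitInterval
  mono : ∀ i, Monotone (threshold i)

namespace Thresholds

variable {n s : ℕ}

/-- All thresholds of bidder `i`, including `θ_0 = 0` and `θ_{s+1} = 1`. -/
def fullThreshold (θ : Thresholds n s) (i : Fin n) (j : ℕ) : unitInterval :=
  if j = 0 then 0 else if h : j - 1 < s then θ.threshold i ⟨j - 1, h⟩ else 1

open Classical in
/-- The index of bidder `i` with value `x`: the largest `j ∈ {0, …, s+1}` with `θ_j ≤ x`. -/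
def index (θ : Thresholds n s) (i : Fin n) (x : unitInterval) : ℕ :=
  Nat.findGreatest (fun j => θ.fullThreshold i j ≤ x) (s + 1)

/-- Bidder `i` wins if his index is positive and the highest one, ties being broken in favour of
the bidder with the smaller number.  Index `0` (below `θ_1`) stands for a negative virtual value:
such a bidder is not served. -/
def Wins (θ : Thresholds n s) (v : Profile n) (i : Fin n) : Prop :=
  0 < θ.index i (v i) ∧
    ∀ k, k ≠ i → θ.index k (v k) < θ.index i (v i) ∨
      (θ.index k (v k) = θ.index i (v i) ∧ i < k)

open Classical in
/-- The level auction with these thresholds: the winner pays the lowest bid with which he would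
still win, all others pay nothing. -/
def auction (θ : Thresholds n s) : Auction n where
  alloc v i := if θ.Wins v i then 1 else 0
  pay v i :=
    if θ.Wins v i then
      sInf {x : ℝ | ∃ b : unitInterval, (b : ℝ) = x ∧ θ.Wins (Function.update v i b) i}
    else 0

end Thresholds

/-- The supremum of the expected revenue over the level auctions with `s` free thresholds per
bidder, i.e. with grid width `1 / s`. -/
def levelOPT {n : ℕ} (s : ℕ) (D : Fin n → Measure unitInterval) : ℝ :=
  ⨆ θ : Thresholds n s, expectedRevenue D θ.auction

/-- A finite sample of value profiles (with multiplicities). -/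
abbrev Sample (n : ℕ) := Multiset (Profile n)

/-- The sample that consists of the `m` given draws. -/
def sampleOf {n m : ℕ} (z : Fin m → Profile n) : Sample n := Finset.univ.val.map z

/-- `R_T(θ)`: average revenue on the sample `T`. -/
def empiricalRevenue {n s : ℕ} (T : Sample n) (θ : Thresholds n s) : ℝ :=
  (T.map θ.auction.revenue).sum / (T.card : ℝ)

/-- `h` is an empirical revenue maximization rule for the level auctions with `s` thresholds per
bidder, whose tie-breaking selects thresholds at values of the same bidder in the sample, or
at the upper end `1`. -/
structure IsERM {n s : ℕ} (h : Sample n → Thresholds n s) : Prop where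
  maximizes : ∀ (T : Sample n) (θ : Thresholds n s),
    empiricalRevenue T θ ≤ empiricalRevenue T (h T)
  at_sample : ∀ (T : Sample n) (i : Fin n) (j : Fin s),
    (h T).threshold i j = 1 ∨ ∃ v ∈ T, (h T).threshold i j = v i
  measurable : ∀ (m : ℕ) (i : Fin n) (j : Fin s),
    Measurable fun z : Fin m → Profile n => (h (sampleOf z)).threshold i j

/-- The split-sample hypothesis space: outputs of `h` on sub-samples of size `⌈|S| / 2⌉`. -/
def splitSample {n s : ℕ} (h : Sample n → Thresholds n s) (S : Sample n) :
    Set (Thresholds n s) :=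
  {θ | ∃ T : Sample n, T ≤ S ∧ T.card = (S.card + 1) / 2 ∧ h T = θ}

/-- The split-sample growth rate. -/
def growthRate {n s : ℕ} (h : Sample n → Thresholds n s) (m : ℕ) : ℕ∞ :=
  ⨆ S : {S : Sample n // S.card = m}, (splitSample h S.1).encard

/-- `E_S[R_D(h_S)]` for a sample `S` of `m` independent draws from the product of the `D i`. -/
def expectedLearnedRevenue {n s : ℕ} (D : Fin n → Measure unitInterval)
    (h : Sample n → Thresholds n s) (m : ℕ) : ℝ :=
  ∫ z, expectedRevenue D (h (sampleOf z)).auction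
    ∂(Measure.pi fun _ : Fin m => Measure.pi D)

/-- `(2 n log (2m) / m)^{1/3}`. -/
def gridWidth (n m : ℕ) : ℝ :=
  (2 * (n : ℝ) * Real.log (2 * (m : ℝ)) / (m : ℝ)) ^ (1 / 3 : ℝ)

/-- The number of thresholds per bidder used on `m` samples: the reciprocal of the grid width,
rounded up to an integer. -/
def levels (n m : ℕ) : ℕ := ⌈1 / gridWidth n m⌉₊

/-- The `M` such that, for every number `m ≥ M` of samples and all value distributions on `[0,1]`,
running on `m` samples the rule `h s` with `s = levels n m` loses at most `ε` against `OPT`. The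
sample complexity at accuracy `ε` is the least element of this set. -/
def accurateFrom {n : ℕ} (h : ∀ s : ℕ, Sample n → Thresholds n s) (ε : ℝ) : Set ℕ :=
  {M | ∀ m, M ≤ m → ∀ D : Fin n → Measure unitInterval, (∀ i, IsProbabilityMeasure (D i)) →
    OPT D - ε ≤ expectedLearnedRevenue D (h (levels n m)) m}

end LevelAuctions

end

/-!
Sampling. An empirically optimal auction errs by at most its gap between the sample and an
independent ghost sample. Exchanging sample and ghost draws pairwise at random never leaves the
subsamples of size `m` of the fixed union `S` of the two, so the rule can only choose among its
outputs on these, and Massart's lemma bounds the gap in terms of their number. As thresholds are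
sample values and increase, they are determined by multisets of values, hence there are at most
`(2 * m) ^ (n * s)` of them.

Approximation. For each bidder and each `k ≤ s` post the largest optimal price when the item is
worth `k / s` to the seller. These prices increase with `k`, and the fraction of prices that a value
reaches replaces the virtual value. Comparing consecutive optimal prices shows that a posted price
earns at most the expected fraction at the values accepting it, hence so does every truthful
single-bidder mechanism, being a lottery over posted prices. An auction therefore earns at most the
expected fraction of the winner, which is largest if the highest index wins; the level auction with
these prices as thresholds does this and, by optimality of the same prices, earns this fraction up
to a single grid step `1 / s`.

The grid width `1 / s` and the sampling error `√(s * e ^ 3)`, where `e = gridWidth n m`, balance at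
`s = 1 / e`.
-/

noncomputable section

namespace LevelAuctions

/-! ### Massart's finite class lemma -/

theorem sum_le_card_mul_of_sum_exp_le {Ω : Type*} (s : Finset Ω) {f : Ω → ℝ} {b : ℝ}
    (h : ∑ ω ∈ s, Real.exp (f ω) ≤ s.card * Real.exp b) : ∑ ω ∈ s, f ω ≤ s.card * b := by
  have tangent : ∀ ω, f ω ≤ Real.exp (f ω) / Real.exp b - 1 + b := fun ω => by
    have := Real.add_one_le_exp (f ω - b)
    rw [Real.exp_sub] at this
    linarith
  calc ∑ ω ∈ s, f ω ≤ ∑ ω ∈ s, (Real.exp (f ω) / Real.exp b - 1 + b) :=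
        Finset.sum_le_sum fun ω _ => tangent ω
    _ = (∑ ω ∈ s, Real.exp (f ω)) / Real.exp b + s.card * (b - 1) := by
        simp only [Finset.sum_add_distrib, Finset.sum_sub_distrib, Finset.sum_div,
          Finset.sum_const, nsmul_eq_mul]
        ring
    _ ≤ s.card + s.card * (b - 1) := by
        gcongr
        exact (div_le_iff₀ (Real.exp_pos b)).2 h
    _ = s.card * b := by ring

section Massart

variable {ι : Type*} [Fintype ι] [DecidableEq ι]

theorem sum_exp_sum_sign_mul_le (a : ι → ℝ) :
    ∑ σ : ι → ℤˣ, Real.exp (∑ i, ((σ i : ℤ) : ℝ) * a i)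
      ≤ 2 ^ Fintype.card ι * Real.exp ((∑ i, a i ^ 2) / 2) := by
  have cosh_eq : ∀ i, ∑ b : ℤˣ, Real.exp (((b : ℤ) : ℝ) * a i) = 2 * Real.cosh (a i) := by
    intro i
    rw [show (Finset.univ : Finset ℤˣ) = {1, -1} from rfl, Finset.sum_pair (by decide),
      Real.cosh_eq]
    push_cast
    ring_nf
  calc ∑ σ : ι → ℤˣ, Real.exp (∑ i, ((σ i : ℤ) : ℝ) * a i)
      = ∏ i, ∑ b : ℤˣ, Real.exp (((b : ℤ) : ℝ) * a i) := by
        simp only [Real.exp_sum, Fintype.prod_sum]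
    _ = ∏ i, 2 * Real.cosh (a i) := by simp only [cosh_eq]
    _ ≤ ∏ i, 2 * Real.exp (a i ^ 2 / 2) := by
        gcongr with i
        exact Real.cosh_le_exp_half_sq (a i)
    _ = 2 ^ Fintype.card ι * Real.exp ((∑ i, a i ^ 2) / 2) := by
        rw [Finset.prod_mul_distrib, Finset.prod_const, Finset.card_univ, ← Real.exp_sum,
          Finset.sum_div]

theorem mul_sum_sign_select_le {H : Type*} (F : Finset H) {a : H → ι → ℝ} {V : ℝ}
    (ha : ∀ θ ∈ F, ∑ i, a θ i ^ 2 ≤ V) {c : (ι → ℤˣ) → H} (hc : ∀ σ, c σ ∈ F) (l : ℝ) :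
    l * ∑ σ : ι → ℤˣ, ∑ i, ((σ i : ℤ) : ℝ) * a (c σ) i
      ≤ 2 ^ Fintype.card ι * (Real.log F.card + l ^ 2 * V / 2) := by
  have card_pos : (0 : ℝ) < F.card := Nat.cast_pos.2 (Finset.card_pos.2 ⟨_, hc 1⟩)
  have moment : ∀ θ ∈ F, ∑ σ : ι → ℤˣ, Real.exp (∑ i, ((σ i : ℤ) : ℝ) * (l * a θ i))
      ≤ 2 ^ Fintype.card ι * Real.exp (l ^ 2 * V / 2) := fun θ hθ => by
    refine (sum_exp_sum_sign_mul_le fun i => l * a θ i).trans ?_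
    simp only [mul_pow, ← Finset.mul_sum]
    gcongr
    exact ha θ hθ
  have card_signs : ((Finset.univ : Finset (ι → ℤˣ)).card : ℝ) = 2 ^ Fintype.card ι := by
    simp [Finset.card_univ, Fintype.card_units_int]
  have exp_moment : ∑ σ : ι → ℤˣ, Real.exp (l * ∑ i, ((σ i : ℤ) : ℝ) * a (c σ) i)
      ≤ (Finset.univ : Finset (ι → ℤˣ)).card * Real.exp (Real.log F.card + l ^ 2 * V / 2) := by
    calc ∑ σ : ι → ℤˣ, Real.exp (l * ∑ i, ((σ i : ℤ) : ℝ) * a (c σ) i)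
        = ∑ σ : ι → ℤˣ, Real.exp (∑ i, ((σ i : ℤ) : ℝ) * (l * a (c σ) i)) := by
          simp only [Finset.mul_sum, mul_left_comm l]
      _ ≤ ∑ σ : ι → ℤˣ, ∑ θ ∈ F, Real.exp (∑ i, ((σ i : ℤ) : ℝ) * (l * a θ i)) :=
          Finset.sum_le_sum fun σ _ => Finset.single_le_sum
            (f := fun θ => Real.exp (∑ i, ((σ i : ℤ) : ℝ) * (l * a θ i)))
            (fun θ _ => (Real.exp_pos _).le) (hc σ)
      _ = ∑ θ ∈ F, ∑ σ : ι → ℤˣ, Real.exp (∑ i, ((σ i : ℤ) : ℝ) * (l * a θ i)) :=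
          Finset.sum_comm
      _ ≤ F.card • (2 ^ Fintype.card ι * Real.exp (l ^ 2 * V / 2)) :=
          Finset.sum_le_card_nsmul _ _ _ moment
      _ = _ := by
          rw [nsmul_eq_mul, card_signs, Real.exp_add, Real.exp_log card_pos]
          ring
  rw [Finset.mul_sum, ← card_signs]
  exact sum_le_card_mul_of_sum_exp_le _ exp_moment

theorem sum_sign_select_le {H : Type*} (F : Finset H) {a : H → ι → ℝ} {V : ℝ}
    (ha : ∀ θ ∈ F, ∑ i, a θ i ^ 2 ≤ V) {c : (ι → ℤˣ) → H} (hc : ∀ σ, c σ ∈ F) :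
    ∑ σ : ι → ℤˣ, ∑ i, ((σ i : ℤ) : ℝ) * a (c σ) i
      ≤ 2 ^ Fintype.card ι * Real.sqrt (2 * V * Real.log F.card) := by
  set N : ℝ := 2 ^ Fintype.card ι
  have N_pos : 0 < N := by positivity
  set x := ∑ σ : ι → ℤˣ, ∑ i, ((σ i : ℤ) : ℝ) * a (c σ) i
  -- The bounds for all `l` say that a quadratic polynomial in `l` is nonnegative.
  have discrim_nonpos : discrim (N * V / 2) (-x) (N * Real.log F.card) ≤ 0 :=
    discrim_le_zero fun l => by linarith [mul_sum_sign_select_le F ha hc l]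
  rw [← Real.sqrt_sq N_pos.le, ← Real.sqrt_mul (sq_nonneg N)]
  refine Real.le_sqrt_of_sq_le ?_
  rw [discrim] at discrim_nonpos
  linarith

end Massart

/-! ### Symmetrization with a ghost sample -/

theorem integral_comp_measurePreserving {α β E : Type*} [MeasurableSpace α] [MeasurableSpace β]
    [NormedAddCommGroup E] [NormedSpace ℝ E] {μ : Measure α} {ν : Measure β} {T : α → β}
    (hT : MeasurePreserving T μ ν) {f : β → E} (hf : AEStronglyMeasurable f ν) :
    ∫ x, f (T x) ∂μ = ∫ y, f y ∂ν := by
  rw [← hT.map_eq] at hf ⊢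
  rw [integral_map hT.aemeasurable hf]

section Learning

variable {ι X H : Type*} [Fintype ι]

/-- The sample, with multiplicities, that consists of the given draws. -/
def drawnSample (z : ι → X) : Multiset X := Finset.univ.val.map z

theorem drawnSample_eq_sum (z : ι → X) : drawnSample z = ∑ i, {z i} := by
  unfold drawnSample
  rw [Finset.sum, ← Multiset.sum_map_singleton (Finset.univ.val.map z), Multiset.map_map]
  rfl

theorem card_drawnSample (z : ι → X) : (drawnSample z).card = Fintype.card ι := by
  simp [drawnSample, Finset.card_univ]

/-- Exchange the entries of the pairs whose sign is `-1`. -/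
def swapAt (σ : ι → ℤˣ) (w : ι → X × X) (i : ι) : X × X :=
  if σ i = 1 then w i else (w i).swap

theorem drawnSample_fst_add_snd_swapAt (σ : ι → ℤˣ) (w : ι → X × X) :
    drawnSample (fun i => (swapAt σ w i).1) + drawnSample (fun i => (swapAt σ w i).2)
      = drawnSample (fun i => (w i).1) + drawnSample fun i => (w i).2 := by
  simp only [drawnSample_eq_sum, ← Finset.sum_add_distrib]
  refine Finset.sum_congr rfl fun i _ => ?_
  unfold swapAt
  split_ifs
  · rfl
  · exact add_comm _ _

theorem measurePreserving_swapAt [MeasurableSpace X] (P : Measure X) [IsProbabilityMeasure P]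
    (σ : ι → ℤˣ) :
    MeasurePreserving (swapAt σ) (Measure.pi fun _ => P.prod P)
      (Measure.pi fun _ => P.prod P) := by
  refine measurePreserving_pi (fun _ : ι => P.prod P) (fun _ => P.prod P)
    (f := fun i q => if σ i = 1 then q else q.swap) fun i => ?_
  by_cases hσ : σ i = 1
  · simp only [hσ, if_true]
    exact .id _
  · simp only [hσ, if_false]
    exact Measure.measurePreserving_swap

/-- The amount by which the output of the learning rule `h` on the first entries of the pairs `w`
earns more on these than on the second entries, the ghost sample. -/
def ghostGap (r : H → X → ℝ) (h : Multiset X → H) (w : ι → X × X) : ℝ :=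
  ∑ i, (r (h (drawnSample fun j => (w j).1)) (w i).1
    - r (h (drawnSample fun j => (w j).1)) (w i).2)

theorem ghostGap_swapAt (r : H → X → ℝ) (h : Multiset X → H) (σ : ι → ℤˣ) (w : ι → X × X) :
    ghostGap r h (swapAt σ w) = ∑ i, ((σ i : ℤ) : ℝ) *
      (r (h (drawnSample fun j => (swapAt σ w j).1)) (w i).1
        - r (h (drawnSample fun j => (swapAt σ w j).1)) (w i).2) := by
  refine Finset.sum_congr rfl fun i _ => ?_
  generalize h (drawnSample fun j => (swapAt σ w j).1) = θ
  rcases Int.units_eq_one_or (σ i) with hσ | hσ <;> simp [swapAt, hσ]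

theorem measurable_ghostGap [MeasurableSpace X] {r : H → X → ℝ} {h : Multiset X → H}
    (hmeas : Measurable fun q : (ι → X) × X => r (h (drawnSample q.1)) q.2) :
    Measurable (ghostGap (ι := ι) r h) :=
  Finset.measurable_sum _ fun i _ =>
    (hmeas.comp (f := fun w : ι → X × X => (fun j => (w j).1, (w i).1)) (by fun_prop)).sub
      (hmeas.comp (f := fun w : ι → X × X => (fun j => (w j).1, (w i).2)) (by fun_prop))

variable {r : H → X → ℝ} (hr : ∀ θ x, r θ x ∈ Set.Icc (0 : ℝ) 1)

include hr

theorem abs_ghostGap_le (h : Multiset X → H) (w : ι → X × X) :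
    |ghostGap r h w| ≤ Fintype.card ι := by
  refine (Finset.abs_sum_le_sum_abs _ _).trans ((Finset.sum_le_card_nsmul _ _ 1 fun i _ => ?_).trans
    (by simp [Finset.card_univ]))
  exact Real.dist_le_of_mem_Icc_01 (hr _ _) (hr _ _)

theorem sum_ghostGap_swapAt_le [DecidableEq ι] {h : Multiset X → H} {K : ℕ}
    (hK : ∀ S : Multiset X, S.card = 2 * Fintype.card ι →
      (h '' {T | T ≤ S ∧ T.card = Fintype.card ι}).encard ≤ K) (w : ι → X × X) :
    ∑ σ : ι → ℤˣ, ghostGap r h (swapAt σ w)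
      ≤ 2 ^ Fintype.card ι * Real.sqrt (2 * Fintype.card ι * Real.log K) := by
  set S := drawnSample (fun i => (w i).1) + drawnSample fun i => (w i).2 with hS
  have card_S : S.card = 2 * Fintype.card ι := by
    rw [hS, Multiset.card_add, card_drawnSample, card_drawnSample, two_mul]
  have finite_outputs := Set.finite_of_encard_le_coe (hK S card_S)
  have card_outputs : finite_outputs.toFinset.card ≤ K := by
    have := hK S card_S
    rw [finite_outputs.encard_eq_coe_toFinset_card] at this
    exact_mod_cast this
  have output_mem : ∀ σ : ι → ℤˣ,
      h (drawnSample fun i => (swapAt σ w i).1) ∈ finite_outputs.toFinset := fun σ =>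
    finite_outputs.mem_toFinset.2 ⟨_, ⟨by
      rw [hS, ← drawnSample_fst_add_snd_swapAt σ w]
      exact Multiset.le_add_right _ _, card_drawnSample _⟩, rfl⟩
  have sq_gap_le : ∀ θ ∈ finite_outputs.toFinset,
      ∑ i, (r θ (w i).1 - r θ (w i).2) ^ 2 ≤ Fintype.card ι := fun θ _ => by
    refine (Finset.sum_le_card_nsmul _ _ 1 fun i _ => ?_).trans (by simp [Finset.card_univ])
    exact (sq_le_one_iff_abs_le_one _).2 (Real.dist_le_of_mem_Icc_01 (hr _ _) (hr _ _))
  simp only [ghostGap_swapAt]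
  refine (sum_sign_select_le _ sq_gap_le output_mem).trans ?_
  gcongr
  exact Nat.cast_pos.2 (Finset.card_pos.2 ⟨_, output_mem 1⟩)

variable [MeasurableSpace X] {h : Multiset X → H}
  (hmeas : Measurable fun q : (ι → X) × X => r (h (drawnSample q.1)) q.2)

include hmeas

theorem integrable_ghostGap (Q : Measure (ι → X × X)) [IsFiniteMeasure Q] :
    Integrable (ghostGap r h) Q :=
  .of_bound (measurable_ghostGap hmeas).aestronglyMeasurable _
    (.of_forall (abs_ghostGap_le hr h))

theorem integral_ghostGap_le {K : ℕ}
    (hK : ∀ S : Multiset X, S.card = 2 * Fintype.card ι →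
      (h '' {T | T ≤ S ∧ T.card = Fintype.card ι}).encard ≤ K)
    (P : Measure X) [IsProbabilityMeasure P] :
    ∫ w, ghostGap r h w ∂(Measure.pi fun _ : ι => P.prod P)
      ≤ Real.sqrt (2 * Fintype.card ι * Real.log K) := by
  classical
  set Q := Measure.pi fun _ : ι => P.prod P
  have integrable_swapped : ∀ σ : ι → ℤˣ, Integrable (fun w => ghostGap r h (swapAt σ w)) Q :=
    fun σ => (measurePreserving_swapAt P σ).integrable_comp_of_integrable
      (integrable_ghostGap hr hmeas Q)
  have average_swapped : ∫ w, ∑ σ : ι → ℤˣ, ghostGap r h (swapAt σ w) ∂Q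
      = 2 ^ Fintype.card ι * ∫ w, ghostGap r h w ∂Q := by
    rw [integral_finsetSum _ fun σ _ => integrable_swapped σ]
    simp [integral_comp_measurePreserving (measurePreserving_swapAt P _)
      (measurable_ghostGap hmeas).aestronglyMeasurable, Q]
  refine le_of_mul_le_mul_left ?_ (pow_pos two_pos (Fintype.card ι))
  rw [← average_swapped]
  refine (integral_mono (integrable_finsetSum _ fun σ _ => integrable_swapped σ)
    (integrable_const _) (sum_ghostGap_swapAt_le hr hK)).trans (by simp)

theorem integral_reward_ghost (P : Measure X) [IsProbabilityMeasure P] (i : ι) :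
    ∫ w : ι → X × X, r (h (drawnSample fun j => (w j).1)) (w i).2
        ∂(Measure.pi fun _ => P.prod P)
      = ∫ z, ∫ x, r (h (drawnSample z)) x ∂P ∂(Measure.pi fun _ : ι => P) := by
  have meas_eval : Measurable fun q : (ι → X) × (ι → X) => r (h (drawnSample q.1)) (q.2 i) :=
    hmeas.comp (f := fun q : (ι → X) × (ι → X) => (q.1, q.2 i)) (by fun_prop)
  refine (integral_comp_measurePreserving (measurePreserving_arrowProdEquivProdArrow X X ι
    (fun _ => P) fun _ => P) meas_eval.aestronglyMeasurable).trans ?_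
  rw [integral_prod _ (.of_mem_Icc 0 1 meas_eval.aemeasurable (.of_forall fun q => hr _ _))]
  refine integral_congr_ae (.of_forall fun z => ?_)
  exact integral_comp_measurePreserving (measurePreserving_eval (fun _ : ι => P) i)
    (hmeas.comp measurable_prodMk_left).aestronglyMeasurable

theorem card_mul_sub_le_of_maximizes {θ : H} (hθ : Measurable (r θ))
    (hmax : ∀ z : ι → X, ∑ i, r θ (z i) ≤ ∑ i, r (h (drawnSample z)) (z i))
    (P : Measure X) [IsProbabilityMeasure P] :
    Fintype.card ι * (∫ x, r θ x ∂P
        - ∫ z, ∫ x, r (h (drawnSample z)) x ∂P ∂(Measure.pi fun _ : ι => P))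
      ≤ ∫ w, ghostGap r h w ∂(Measure.pi fun _ : ι => P.prod P) := by
  set Q := Measure.pi fun _ : ι => P.prod P
  have measurePreserving_fst_eval : ∀ i, MeasurePreserving (fun w : ι → X × X => (w i).1) Q P :=
    fun i => measurePreserving_fst.comp (measurePreserving_eval (fun _ : ι => P.prod P) i)
  have integrable_fixed : ∀ i, Integrable (fun w : ι → X × X => r θ (w i).1) Q := fun i =>
    (measurePreserving_fst_eval i).integrable_comp_of_integrable
      (.of_mem_Icc 0 1 hθ.aemeasurable (.of_forall (hr θ)))
  have integrable_ghost : ∀ i, Integrable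
      (fun w : ι → X × X => r (h (drawnSample fun j => (w j).1)) (w i).2) Q := fun i =>
    .of_mem_Icc 0 1 (hmeas.comp (f := fun w : ι → X × X => (fun j => (w j).1, (w i).2))
      (by fun_prop)).aemeasurable (.of_forall fun w => hr _ _)
  calc Fintype.card ι * (∫ x, r θ x ∂P
        - ∫ z, ∫ x, r (h (drawnSample z)) x ∂P ∂(Measure.pi fun _ : ι => P))
      = ∑ i, ∫ w, (r θ (w i).1 - r (h (drawnSample fun j => (w j).1)) (w i).2) ∂Q := by
        rw [Finset.sum_congr rfl fun i _ => by
          rw [integral_sub (integrable_fixed i) (integrable_ghost i),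
            integral_comp_measurePreserving (measurePreserving_fst_eval i)
              hθ.aestronglyMeasurable, integral_reward_ghost hr hmeas P i]]
        rw [Finset.sum_const, Finset.card_univ, nsmul_eq_mul]
    _ = ∫ w, ∑ i, (r θ (w i).1 - r (h (drawnSample fun j => (w j).1)) (w i).2) ∂Q :=
        (integral_finsetSum _ fun i _ => (integrable_fixed i).sub (integrable_ghost i)).symm
    _ ≤ ∫ w, ghostGap r h w ∂Q := by
        refine integral_mono (integrable_finsetSum _ fun i _ =>
          (integrable_fixed i).sub (integrable_ghost i))
          (integrable_ghostGap hr hmeas Q) fun w => ?_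
        simp only [ghostGap, Finset.sum_sub_distrib]
        exact sub_le_sub_right (hmax fun i => (w i).1) _

theorem integral_sub_sqrt_le_of_maximizes [Nonempty ι] {K : ℕ}
    (hK : ∀ S : Multiset X, S.card = 2 * Fintype.card ι →
      (h '' {T | T ≤ S ∧ T.card = Fintype.card ι}).encard ≤ K)
    {θ : H} (hθ : Measurable (r θ))
    (hmax : ∀ z : ι → X, ∑ i, r θ (z i) ≤ ∑ i, r (h (drawnSample z)) (z i))
    (P : Measure X) [IsProbabilityMeasure P] :
    ∫ x, r θ x ∂P - Real.sqrt (2 * Real.log K / Fintype.card ι)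
      ≤ ∫ z, ∫ x, r (h (drawnSample z)) x ∂P ∂(Measure.pi fun _ : ι => P) := by
  have card_pos : (0 : ℝ) < Fintype.card ι := Nat.cast_pos.2 Fintype.card_pos
  have gap_le := (card_mul_sub_le_of_maximizes hr hmeas hθ hmax P).trans
    (integral_ghostGap_le hr hmeas hK P)
  rw [show 2 * Fintype.card ι * Real.log K
      = (Fintype.card ι : ℝ) ^ 2 * (2 * Real.log K / Fintype.card ι) by field_simp,
    Real.sqrt_mul (sq_nonneg _), Real.sqrt_sq card_pos.le] at gap_le
  linarith [le_of_mul_le_mul_left gap_le card_pos]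

end Learning

/-! ### Truthful auctions -/

namespace Auction.IsTruthful

variable {n : ℕ} {A : Auction n}

theorem pay_le_alloc (hA : A.IsTruthful) (v : Profile n) (i : Fin n) :
    A.pay v i ≤ A.alloc v i :=
  (sub_nonneg.1 (hA.individually_rational v i)).trans
    (mul_le_of_le_one_left (hA.alloc_nonneg v i) (unitInterval.le_one (v i)))

theorem alloc_le_one (hA : A.IsTruthful) (v : Profile n) (i : Fin n) : A.alloc v i ≤ 1 :=
  (Finset.single_le_sum (fun k _ => hA.alloc_nonneg v k) (Finset.mem_univ i)).trans
    (hA.alloc_sum_le_one v)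

theorem revenue_mem_Icc (hA : A.IsTruthful) (v : Profile n) : A.revenue v ∈ Set.Icc (0 : ℝ) 1 :=
  ⟨hA.revenue_nonneg v,
    (Finset.sum_le_sum fun i _ => hA.pay_le_alloc v i).trans (hA.alloc_sum_le_one v)⟩

theorem pay_mem_Icc (hA : A.IsTruthful) (v : Profile n) (i : Fin n) :
    A.pay v i ∈ Set.Icc (-1 : ℝ) 1 := by
  refine ⟨?_, (hA.pay_le_alloc v i).trans (hA.alloc_le_one v i)⟩
  have revenue_nonneg := hA.revenue_nonneg v
  have alloc_le := hA.alloc_sum_le_one v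
  rw [revenue, ← Finset.add_sum_erase _ _ (Finset.mem_univ i)] at revenue_nonneg
  rw [← Finset.add_sum_erase _ _ (Finset.mem_univ i)] at alloc_le
  have others_le := Finset.sum_le_sum fun k (_ : k ∈ Finset.univ.erase i) => hA.pay_le_alloc v k
  linarith [hA.alloc_nonneg v i]

theorem measurable_revenue (hA : A.IsTruthful) : Measurable A.revenue :=
  Finset.measurable_sum _ fun i _ => hA.measurable_pay i

section Integrals

variable {P : Measure (Profile n)} [IsFiniteMeasure P]

theorem integrable_alloc (hA : A.IsTruthful) (i : Fin n) :
    Integrable (fun v => A.alloc v i) P :=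
  .of_mem_Icc 0 1 (hA.measurable_alloc i).aemeasurable
    (.of_forall fun v => ⟨hA.alloc_nonneg v i, hA.alloc_le_one v i⟩)

theorem integrable_pay (hA : A.IsTruthful) (i : Fin n) : Integrable (fun v => A.pay v i) P :=
  .of_mem_Icc (-1) 1 (hA.measurable_pay i).aemeasurable (.of_forall fun v => hA.pay_mem_Icc v i)

end Integrals

variable (D : Fin n → Measure unitInterval) [∀ i, IsProbabilityMeasure (D i)]

theorem expectedRevenue_eq_sum (hA : A.IsTruthful) :
    expectedRevenue D A = ∑ i, ∫ v, A.pay v i ∂(Measure.pi D) :=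
  integral_finsetSum _ fun i _ => hA.integrable_pay i

theorem expectedRevenue_mem_Icc (hA : A.IsTruthful) :
    expectedRevenue D A ∈ Set.Icc (0 : ℝ) 1 :=
  (convex_Icc 0 1).integral_mem isClosed_Icc (.of_forall hA.revenue_mem_Icc)
    (.of_mem_Icc 0 1 hA.measurable_revenue.aemeasurable (.of_forall hA.revenue_mem_Icc))

end Auction.IsTruthful

/-! ### Level auctions -/

namespace Thresholds

variable {n s : ℕ}

instance : Nonempty (Thresholds n s) := ⟨⟨fun _ _ => 1, fun _ => monotone_const⟩⟩

theorem fullThreshold_zero (θ : Thresholds n s) (i : Fin n) : θ.fullThreshold i 0 = 0 := by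
  simp [fullThreshold]

theorem fullThreshold_succ (θ : Thresholds n s) (i : Fin n) (j : Fin s) :
    θ.fullThreshold i (j + 1) = θ.threshold i j := by
  simp [fullThreshold]

theorem fullThreshold_of_lt (θ : Thresholds n s) (i : Fin n) {j : ℕ} (hj : s < j) :
    θ.fullThreshold i j = 1 := by
  have ne_zero : j ≠ 0 := by omega
  have not_lt : ¬ j - 1 < s := by omega
  simp [fullThreshold, ne_zero, not_lt]

theorem fullThreshold_mono (θ : Thresholds n s) (i : Fin n) : Monotone (θ.fullThreshold i) := by
  refine monotone_nat_of_le_succ fun j => ?_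
  rcases lt_or_ge j s with hj | hj
  · rw [fullThreshold_succ θ i ⟨j, hj⟩]
    cases j with
    | zero => exact fullThreshold_zero θ i ▸ unitInterval.nonneg'
    | succ j =>
      rw [fullThreshold_succ θ i ⟨j, by omega⟩]
      exact θ.mono i (Fin.mk_le_mk.2 j.le_succ)
  · rw [fullThreshold_of_lt θ i (Nat.lt_succ_of_le hj)]
    exact unitInterval.le_one'

theorem index_le (θ : Thresholds n s) (i : Fin n) (x : unitInterval) : θ.index i x ≤ s + 1 :=
  Nat.findGreatest_le _

theorem le_index_iff (θ : Thresholds n s) (i : Fin n) (x : unitInterval) {j : ℕ}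
    (hj : j ≤ s + 1) : j ≤ θ.index i x ↔ θ.fullThreshold i j ≤ x := by
  classical
  refine ⟨fun h => (θ.fullThreshold_mono i h).trans ?_, fun h => Nat.le_findGreatest hj h⟩
  refine Nat.findGreatest_spec (P := fun j => θ.fullThreshold i j ≤ x) (Nat.zero_le (s + 1)) ?_
  exact (fullThreshold_zero θ i).trans_le unitInterval.nonneg'

/-- The indices of all bidders. -/
def indices (θ : Thresholds n s) (v : Profile n) (k : Fin n) : ℕ := θ.index k (v k)

/-- The lowest index with which bidder `i` wins when the others have indices `J`; the entry `J i`
is ignored. -/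
def winLevel (i : Fin n) (J : Fin n → ℕ) : ℕ :=
  max 1 ((Finset.univ.erase i).sup fun k => J k + if k < i then 1 else 0)

theorem winLevel_pos (i : Fin n) (J : Fin n → ℕ) : 0 < winLevel i J :=
  lt_max_of_lt_left one_pos

theorem winLevel_congr {i : Fin n} {J J' : Fin n → ℕ} (h : ∀ k, k ≠ i → J k = J' k) :
    winLevel i J = winLevel i J' := by
  unfold winLevel
  congr 1
  refine Finset.sup_congr rfl fun k hk => ?_
  rw [h k (Finset.ne_of_mem_erase hk)]

theorem winLevel_indices_update (θ : Thresholds n s) (v : Profile n) (i : Fin n)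
    (b : unitInterval) :
    winLevel i (θ.indices (Function.update v i b)) = winLevel i (θ.indices v) :=
  winLevel_congr fun k hk => by simp [indices, hk]

theorem wins_iff (θ : Thresholds n s) (v : Profile n) (i : Fin n) :
    θ.Wins v i ↔ winLevel i (θ.indices v) ≤ θ.index i (v i) := by
  unfold Wins winLevel indices
  simp only [max_le_iff, Finset.sup_le_iff, Finset.mem_erase, Finset.mem_univ, and_true]
  refine and_congr Nat.succ_le_iff (forall_congr' fun k => imp_congr_right fun hk => ?_)
  rcases lt_or_gt_of_ne hk with h | h
  · simp only [h, if_true, h.not_gt, and_false, or_false]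
    exact Nat.succ_le_iff.symm
  · simp only [h, h.not_gt, if_false, and_true, add_zero]
    exact le_iff_lt_or_eq.symm

theorem Wins.unique {θ : Thresholds n s} {v : Profile n} {i k : Fin n} (hi : θ.Wins v i)
    (hk : θ.Wins v k) : i = k := by
  by_contra hne
  rcases hi.2 k (Ne.symm hne) with h | ⟨_, h⟩ <;> rcases hk.2 i hne with h' | ⟨_, h'⟩ <;> omega

theorem auction_alloc (θ : Thresholds n s) (v : Profile n) (i : Fin n) :
    θ.auction.alloc v i = if winLevel i (θ.indices v) ≤ θ.index i (v i) then 1 else 0 := by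
  simp only [auction, wins_iff]

theorem auction_pay (θ : Thresholds n s) (v : Profile n) (i : Fin n) :
    θ.auction.pay v i = if winLevel i (θ.indices v) ≤ θ.index i (v i) then
      (θ.fullThreshold i (winLevel i (θ.indices v)) : ℝ) else 0 := by
  simp only [auction, wins_iff]
  split_ifs with h
  · have winning_bid_iff : ∀ b : unitInterval,
        winLevel i (θ.indices (Function.update v i b)) ≤ θ.index i (Function.update v i b i) ↔
          θ.fullThreshold i (winLevel i (θ.indices v)) ≤ b := fun b => by
      rw [winLevel_indices_update, Function.update_self,
        le_index_iff θ i b (h.trans (θ.index_le i (v i)))]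
    refine IsLeast.csInf_eq ⟨⟨_, rfl, (winning_bid_iff _).2 le_rfl⟩, ?_⟩
    rintro _ ⟨b, rfl, hb⟩
    exact (winning_bid_iff b).1 hb
  · rfl

theorem auction_pay_nonneg (θ : Thresholds n s) (v : Profile n) (i : Fin n) :
    0 ≤ θ.auction.pay v i := by
  rw [auction_pay]
  split_ifs
  · exact unitInterval.nonneg _
  · exact le_rfl

section Measurability

variable {α : Type*} [MeasurableSpace α] {Θ : α → Thresholds n s} {V : α → Profile n}
  (hΘ : ∀ i j, Measurable fun a => (Θ a).threshold i j) (hV : Measurable V) (i : Fin n)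

include hΘ

theorem measurable_fullThreshold (j : ℕ) : Measurable fun a => (Θ a).fullThreshold i j := by
  unfold fullThreshold
  split_ifs
  · exact measurable_const
  · exact hΘ _ _
  · exact measurable_const

include hV

theorem measurable_index : Measurable fun a => (Θ a).index i (V a i) := by
  classical
  exact measurable_findGreatest fun k _ =>
    measurableSet_le (measurable_fullThreshold hΘ i k) ((measurable_pi_apply i).comp hV)

theorem measurable_winLevel : Measurable fun a => winLevel i ((Θ a).indices (V a)) :=
  (measurable_of_countable (winLevel i)).comp
    (measurable_pi_lambda _ fun k => measurable_index hΘ hV k)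

theorem measurable_alloc : Measurable fun a => (Θ a).auction.alloc (V a) i := by
  simp only [auction_alloc]
  exact Measurable.ite (measurableSet_le (measurable_winLevel hΘ hV i) (measurable_index hΘ hV i))
    measurable_const measurable_const

theorem measurable_pay : Measurable fun a => (Θ a).auction.pay (V a) i := by
  simp only [auction_pay]
  have measurable_threshold : Measurable fun q : ℕ × α => ((Θ q.2).fullThreshold i q.1 : ℝ) :=
    measurable_from_prod_countable_right fun j =>
      measurable_subtype_coe.comp (measurable_fullThreshold hΘ i j)
  exact Measurable.ite
    (measurableSet_le (measurable_winLevel hΘ hV i) (measurable_index hΘ hV i))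
    (measurable_threshold.comp ((measurable_winLevel hΘ hV i).prodMk measurable_id))
    measurable_const

theorem measurable_revenue : Measurable fun a => (Θ a).auction.revenue (V a) :=
  Finset.measurable_sum _ fun i _ => measurable_pay hΘ hV i

end Measurability

theorem auction_alloc_sum_le_one (θ : Thresholds n s) (v : Profile n) :
    ∑ i, θ.auction.alloc v i ≤ 1 := by
  classical
  have card_winners_le : (Finset.univ.filter fun i => θ.Wins v i).card ≤ 1 :=
    Finset.card_le_one.2 fun a ha b hb =>
      Wins.unique (Finset.mem_filter.1 ha).2 (Finset.mem_filter.1 hb).2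
  simp only [auction]
  rw [Finset.sum_boole]
  exact_mod_cast card_winners_le

theorem auction_utility (θ : Thresholds n s) (v : Profile n) (i : Fin n) (b : unitInterval) :
    (v i : ℝ) * θ.auction.alloc (Function.update v i b) i
        - θ.auction.pay (Function.update v i b) i
      = if winLevel i (θ.indices v) ≤ θ.index i b then
          (v i : ℝ) - θ.fullThreshold i (winLevel i (θ.indices v)) else 0 := by
  simp only [auction_alloc, auction_pay, winLevel_indices_update, Function.update_self]
  split_ifs <;> ring

theorem auction_utility_le (θ : Thresholds n s) (v : Profile n) (i : Fin n) (b : unitInterval) :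
    (if winLevel i (θ.indices v) ≤ θ.index i b then
        (v i : ℝ) - θ.fullThreshold i (winLevel i (θ.indices v)) else 0)
      ≤ if winLevel i (θ.indices v) ≤ θ.index i (v i) then
          (v i : ℝ) - θ.fullThreshold i (winLevel i (θ.indices v)) else 0 := by
  by_cases level_le : winLevel i (θ.indices v) ≤ s + 1
  · simp only [le_index_iff θ i _ level_le, ← Subtype.coe_le_coe]
    split_ifs <;> linarith
  · have index_lt : ∀ x, ¬ winLevel i (θ.indices v) ≤ θ.index i x := fun x h =>
      level_le (h.trans (θ.index_le i x))
    simp only [index_lt, if_false, le_refl]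

theorem auction_isTruthful (θ : Thresholds n s) : θ.auction.IsTruthful where
  measurable_alloc i := measurable_alloc (fun _ _ => measurable_const) measurable_id i
  measurable_pay i := measurable_pay (fun _ _ => measurable_const) measurable_id i
  alloc_nonneg v i := by
    rw [auction_alloc]
    split_ifs <;> norm_num
  alloc_sum_le_one := θ.auction_alloc_sum_le_one
  truthful v i b := by
    have truthful_utility := θ.auction_utility v i (v i)
    rw [Function.update_eq_self] at truthful_utility
    rw [auction_utility, truthful_utility]
    exact θ.auction_utility_le v i b
  individually_rational v i := by
    rw [auction_alloc, auction_pay]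
    split_ifs with h
    · rw [mul_one, sub_nonneg]
      exact (le_index_iff θ i _ (h.trans (θ.index_le i _))).1 h
    · simp
  revenue_nonneg v := Finset.sum_nonneg fun i _ => θ.auction_pay_nonneg v i

end Thresholds

section Suprema

variable {n : ℕ} (D : Fin n → Measure unitInterval) [∀ i, IsProbabilityMeasure (D i)]

instance : Nonempty {A : Auction n // A.IsTruthful} :=
  ⟨⟨_, (Classical.arbitrary (Thresholds n 0)).auction_isTruthful⟩⟩

theorem OPT_le_one : OPT D ≤ 1 := ciSup_le fun A => (A.2.expectedRevenue_mem_Icc D).2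

theorem expectedRevenue_le_levelOPT {s : ℕ} (θ : Thresholds n s) :
    expectedRevenue D θ.auction ≤ levelOPT s D :=
  le_ciSup (f := fun θ : Thresholds n s => expectedRevenue D θ.auction)
    ⟨1, Set.forall_mem_range.2 fun θ => (θ.auction_isTruthful.expectedRevenue_mem_Icc D).2⟩ θ

end Suprema

/-! ### Order statistics -/

theorem countP_le_countP {α : Type*} {W : Multiset α} {p q : α → Prop} [DecidablePred p]
    [DecidablePred q] (h : ∀ x ∈ W, p x → q x) : W.countP p ≤ W.countP q := by
  induction W using Quotient.inductionOn with
  | h l => exact List.countP_mono_left fun x hx hpx => by simpa using h x hx (by simpa using hpx)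

theorem exists_mem_countP_le {α : Type*} [LinearOrder α] {W : Multiset α} {p : α → Prop}
    [DecidablePred p] (h : 0 < W.countP p) :
    ∃ x ∈ W, p x ∧ W.countP p ≤ W.countP (· ≤ x) := by
  obtain ⟨y, hy, hpy⟩ := Multiset.countP_pos.1 h
  obtain ⟨x, hx, hmax⟩ := (W.filter p).toFinset.exists_max_image id ⟨y, by simp [hy, hpy]⟩
  rw [Multiset.mem_toFinset, Multiset.mem_filter] at hx
  exact ⟨x, hx.1, hx.2, countP_le_countP fun z hz hpz => hmax z (by simp [hz, hpz])⟩

section OrderStatistics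

variable {α : Type*} [CompleteLinearOrder α]

/-- The order statistic of rank `k` (starting from `0`) of a multiset, or `⊤` if there are at most
`k` elements. -/
def orderStat (W : Multiset α) (k : ℕ) : α := sInf {t | k < W.countP (· ≤ t)}

theorem orderStat_mono (W : Multiset α) : Monotone (orderStat W) :=
  fun _ _ hkl => sInf_le_sInf fun _ ht => hkl.trans_lt ht

theorem orderStat_lt_iff {W : Multiset α} {k : ℕ} {t : α} :
    orderStat W k < t ↔ k < W.countP (· < t) := by
  rw [orderStat, sInf_lt_iff]
  constructor
  · rintro ⟨u, hu, hut⟩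
    exact hu.trans_le (countP_le_countP fun x _ hx => hx.trans_lt hut)
  · intro h
    obtain ⟨x, -, hxt, hx⟩ := exists_mem_countP_le (Nat.zero_lt_of_lt h)
    exact ⟨x, h.trans_le hx, hxt⟩

theorem orderStat_eq_top_or_mem (W : Multiset α) (k : ℕ) :
    orderStat W k = ⊤ ∨ orderStat W k ∈ W := by
  have exists_mem_le : ∀ {t}, k < W.countP (· ≤ t) → ∃ x ∈ W, x ≤ t ∧ k < W.countP (· ≤ x) :=
    fun ht =>
      let ⟨x, hx, hxt, hle⟩ := exists_mem_countP_le (Nat.zero_lt_of_lt ht)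
      ⟨x, hx, hxt, ht.trans_le hle⟩
  rcases Set.eq_empty_or_nonempty {t | k < W.countP (· ≤ t)} with empty | ⟨t, ht⟩
  · exact .inl (by rw [orderStat, empty, sInf_empty])
  · obtain ⟨y, hy, -, hky⟩ := exists_mem_le ht
    obtain ⟨x, hx, hmin⟩ := (W.toFinset.filter fun x => k < W.countP (· ≤ x)).exists_min_image id
      ⟨y, by simp [hy, hky]⟩
    simp only [Finset.mem_filter, Multiset.mem_toFinset, id] at hx hmin
    have isLeast : IsLeast {t | k < W.countP (· ≤ t)} x := ⟨hx.2, fun u hu =>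
      let ⟨z, hz, hzu, hkz⟩ := exists_mem_le hu
      (hmin z ⟨hz, hkz⟩).trans hzu⟩
    exact .inr (by rw [orderStat, isLeast.csInf_eq]; exact hx.1)

theorem le_orderStat_countP_lt (W : Multiset α) (t : α) : t ≤ orderStat W (W.countP (· < t)) :=
  not_lt.1 fun h => lt_irrefl _ (orderStat_lt_iff.1 h)

theorem orderStat_countP_lt_le_iff {W : Multiset α} {t x : α} (hx : x ∈ W) :
    orderStat W (W.countP (· < t)) ≤ x ↔ t ≤ x := by
  refine ⟨(le_orderStat_countP_lt W t).trans, fun htx => sInf_le ?_⟩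
  obtain ⟨W', rfl⟩ := Multiset.exists_cons_of_mem hx
  rw [Set.mem_ofPred_eq, Multiset.countP_cons_of_neg (p := (· < t)) _ htx.not_gt,
    Multiset.countP_cons_of_pos (p := (· ≤ x)) _ le_rfl, Nat.lt_succ_iff]
  exact countP_le_countP fun y _ hy => hy.le.trans htx

theorem measurable_orderStat [TopologicalSpace α] [OrderTopology α] [SecondCountableTopology α]
    [MeasurableSpace α] [BorelSpace α] {ι : Type*} [Fintype ι] (k : ℕ) :
    Measurable fun w : ι → α => orderStat (Finset.univ.val.map w) k := by
  refine measurable_of_Iio fun t => ?_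
  have preimage_eq : (fun w : ι → α => orderStat (Finset.univ.val.map w) k) ⁻¹' Set.Iio t
      = {w | k < ∑ a, if w a < t then 1 else 0} := by
    ext w
    rw [Set.mem_preimage, Set.mem_Iio, orderStat_lt_iff, Multiset.countP_map, Set.mem_ofPred_eq,
      ← Finset.card_filter]
    rfl
  rw [preimage_eq]
  refine measurableSet_lt measurable_const (Finset.measurable_sum _ fun a _ => ?_)
  exact Measurable.ite (measurableSet_lt (measurable_pi_apply a) measurable_const)
    measurable_const measurable_const

end OrderStatistics

/-! ### Empirical revenue maximization -/

theorem exists_measurable_argmax (C : Type*) [Finite C] [Nonempty C] [MeasurableSpace C] :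
    ∃ σ : (C → ℝ) → C, Measurable σ ∧ ∀ (f : C → ℝ) (c : C), f c ≤ f (σ f) := by
  classical
  obtain ⟨g, hg⟩ := exists_surjective_nat C
  have exists_argmax : ∀ f : C → ℝ, ∃ k, ∀ c, f c ≤ f (g k) := fun f => by
    obtain ⟨c₀, hc₀⟩ := Finite.exists_max f
    obtain ⟨k, rfl⟩ := hg c₀
    exact ⟨k, hc₀⟩
  refine ⟨fun f => g (Nat.find (exists_argmax f)), ?_, fun f => Nat.find_spec (exists_argmax f)⟩
  refine (measurable_of_countable g).comp (measurable_find exists_argmax fun k => ?_)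
  simp only [Set.ofPred_forall]
  exact MeasurableSet.iInter fun c =>
    measurableSet_le (measurable_pi_apply c) (measurable_pi_apply (g k))

section EmpiricalRevenueMaximization

variable {n s m : ℕ}

theorem card_sampleOf (z : Fin m → Profile n) : (sampleOf z).card = m := by
  simp [sampleOf]

theorem empiricalRevenue_sampleOf (z : Fin m → Profile n) (θ : Thresholds n s) :
    empiricalRevenue (sampleOf z) θ = (∑ a, θ.auction.revenue (z a)) / m := by
  rw [empiricalRevenue, card_sampleOf, sampleOf, Multiset.map_map]
  rfl

theorem Thresholds.revenue_le_revenue {θ θ' : Thresholds n s} {v : Profile n}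
    (hle : ∀ i j, θ.threshold i j ≤ θ'.threshold i j)
    (hiff : ∀ i j, θ'.threshold i j ≤ v i ↔ θ.threshold i j ≤ v i) :
    θ.auction.revenue v ≤ θ'.auction.revenue v := by
  have fullThreshold_le : ∀ i j, θ.fullThreshold i j ≤ θ'.fullThreshold i j := fun i j => by
    unfold fullThreshold
    split_ifs
    exacts [le_rfl, hle _ _, le_rfl]
  have index_eq : ∀ i, θ'.index i (v i) = θ.index i (v i) := fun i => by
    unfold index
    congr 1
    funext j
    unfold fullThreshold
    split_ifs
    exacts [rfl, propext (hiff _ _), rfl]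
  have indices_eq : θ'.indices v = θ.indices v := funext index_eq
  refine Finset.sum_le_sum fun i _ => ?_
  rw [auction_pay, auction_pay, indices_eq, index_eq]
  split_ifs
  exacts [fullThreshold_le _ _, le_rfl]

/-- Ranks, in a sample of size `m`, of the thresholds of all bidders; rank `m` stands for the
threshold `1`. -/
abbrev ThresholdRanks (n s m : ℕ) :=
  {c : Fin n → Fin s → Fin (m + 1) // ∀ i, Monotone (c i)}

instance (n s m : ℕ) : Nonempty (ThresholdRanks n s m) := ⟨⟨fun _ _ => 0, fun _ _ _ _ => le_rfl⟩⟩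

/-- The thresholds at the sample values of given ranks. -/
def thresholdsOfRanks (T : Sample n) (c : ThresholdRanks n s m) : Thresholds n s where
  threshold i j := orderStat (T.map fun v => v i) (c.1 i j)
  mono i _ _ hjk := orderStat_mono _ (c.2 i hjk)

theorem exists_ranks_empiricalRevenue_le (T : Sample n) (θ : Thresholds n s) :
    ∃ c : ThresholdRanks n s T.card,
      empiricalRevenue T θ ≤ empiricalRevenue T (thresholdsOfRanks T c) := by
  let rank (i : Fin n) (j : Fin s) : ℕ := (T.map fun v => v i).countP (· < θ.threshold i j)
  have rank_lt : ∀ i j, rank i j < T.card + 1 := fun i j =>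
    Nat.lt_succ_of_le ((Multiset.countP_le_card _ _).trans (Multiset.card_map _ _).le)
  have rank_mono : ∀ i, Monotone (rank i) := fun i _ _ hjk =>
    countP_le_countP fun _ _ hx => hx.trans_le (θ.mono i hjk)
  refine ⟨⟨fun i j => ⟨rank i j, rank_lt i j⟩, rank_mono⟩,
    div_le_div_of_nonneg_right (Multiset.sum_map_le_sum_map _ _ fun v hv => ?_)
      (Nat.cast_nonneg _)⟩
  exact Thresholds.revenue_le_revenue (fun i j => le_orderStat_countP_lt _ _)
    fun i j => orderStat_countP_lt_le_iff (Multiset.mem_map_of_mem (fun v => v i) hv)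

theorem thresholdsOfRanks_eq_one_or_mem (T : Sample n) (c : ThresholdRanks n s m) (i : Fin n)
    (j : Fin s) : (thresholdsOfRanks T c).threshold i j = 1 ∨
      ∃ v ∈ T, (thresholdsOfRanks T c).threshold i j = v i :=
  (orderStat_eq_top_or_mem _ _).imp id fun h =>
    let ⟨v, hv, hvi⟩ := Multiset.mem_map.1 h
    ⟨v, hv, hvi.symm⟩

theorem measurable_thresholdsOfRanks (c : ThresholdRanks n s m) (i : Fin n) (j : Fin s) :
    Measurable fun z : Fin m → Profile n => (thresholdsOfRanks (sampleOf z) c).threshold i j := by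
  have measurable_values : Measurable fun (z : Fin m → Profile n) (a : Fin m) => z a i :=
    measurable_pi_lambda _ fun a => (measurable_pi_apply i).comp (measurable_pi_apply a)
  simpa only [thresholdsOfRanks, sampleOf, Multiset.map_map, Function.comp_def] using
    (measurable_orderStat (c.1 i j).val).comp measurable_values

theorem measurable_empiricalRevenue_thresholdsOfRanks (c : ThresholdRanks n s m) :
    Measurable fun z : Fin m → Profile n =>
      empiricalRevenue (sampleOf z) (thresholdsOfRanks (sampleOf z) c) := by
  simp only [empiricalRevenue_sampleOf]
  exact (Finset.measurable_sum _ fun a _ => Thresholds.measurable_revenue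
    (measurable_thresholdsOfRanks c) (measurable_pi_apply a)).div_const _

theorem exists_isERM (n s : ℕ) : ∃ h : Sample n → Thresholds n s, IsERM h := by
  choose σ hσ hmax using fun m => exists_measurable_argmax (ThresholdRanks n s m)
  let bestRanks (m : ℕ) (T : Sample n) : ThresholdRanks n s m :=
    σ m fun c => empiricalRevenue T (thresholdsOfRanks T c)
  refine ⟨fun T => thresholdsOfRanks T (bestRanks T.card T), fun T θ => ?_,
    fun T => thresholdsOfRanks_eq_one_or_mem T _, fun m i j => ?_⟩
  · obtain ⟨c, hc⟩ := exists_ranks_empiricalRevenue_le T θ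
    exact hc.trans (hmax T.card (fun c => empiricalRevenue T (thresholdsOfRanks T c)) c)
  · have measurable_bestRanks : Measurable fun z : Fin m → Profile n => bestRanks m (sampleOf z) :=
      (hσ m).comp (measurable_pi_lambda _ measurable_empiricalRevenue_thresholdsOfRanks)
    have measurable_threshold : Measurable fun q : ThresholdRanks n s m × (Fin m → Profile n) =>
        (thresholdsOfRanks (sampleOf q.2) q.1).threshold i j :=
      measurable_from_prod_countable_right fun c => measurable_thresholdsOfRanks c i j
    convert measurable_threshold.comp (measurable_bestRanks.prodMk measurable_id) using 1
    funext z
    rw [card_sampleOf]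
    rfl

end EmpiricalRevenueMaximization

/-! ### The split-sample growth rate -/

theorem choose_add_le_pow {m s : ℕ} (hm : 4 ≤ m) (hs : 2 ≤ s) : (m + s).choose s ≤ m ^ s := by
  induction s, hs using Nat.le_induction with
  | base =>
    rw [Nat.choose_two_right, Nat.add_succ_sub_one]
    exact Nat.div_le_of_le_mul (by nlinarith)
  | succ s hs ih =>
    refine Nat.le_of_mul_le_mul_right (c := s + 1) ?_ s.succ_pos
    calc (m + (s + 1)).choose (s + 1) * (s + 1)
        = (m + s + 1) * (m + s).choose s := (Nat.add_one_mul_choose_eq (m + s) s).symm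
      _ ≤ (m * (s + 1)) * m ^ s := Nat.mul_le_mul (by nlinarith) ih
      _ = m ^ (s + 1) * (s + 1) := by ring

theorem eq_of_monotone_of_map_univ_eq {α : Type*} [PartialOrder α] {s : ℕ} {f g : Fin s → α}
    (hf : Monotone f) (hg : Monotone g)
    (h : Finset.univ.val.map f = Finset.univ.val.map g) : f = g := by
  rw [Fin.univ_val_map, Fin.univ_val_map, Multiset.coe_eq_coe] at h
  exact List.ofFn_injective (h.eq_of_pairwise (fun _ _ _ _ => le_antisymm)
    (List.sortedLE_ofFn_iff.2 hf).pairwise (List.sortedLE_ofFn_iff.2 hg).pairwise)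

theorem encard_monotone_le {α : Type*} [PartialOrder α] (W : Finset α) (s : ℕ) :
    {f : Fin s → α | Monotone f ∧ ∀ j, f j ∈ W}.encard ≤ ((W.card + s - 1).choose s : ℕ) := by
  classical
  let values (f : {f : Fin s → α | Monotone f ∧ ∀ j, f j ∈ W}) : Sym W s :=
    ⟨Finset.univ.val.map fun j => ⟨f.1 j, f.2.2 j⟩, by simp⟩
  have values_injective : Function.Injective values := fun f g hfg => by
    have values_eq := congrArg (fun v => v.1.map Subtype.val) hfg
    simp only [values, Multiset.map_map] at values_eq
    exact Subtype.ext (eq_of_monotone_of_map_univ_eq f.2.1 g.2.1 values_eq)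
  have card_le := ENat.card_le_card_of_injective values_injective
  rwa [ENat.card_eq_coe_fintype_card (α := Sym W s), Sym.card_sym_eq_choose,
    Fintype.card_coe] at card_le

section GrowthRate

variable {n s : ℕ}

theorem encard_thresholds_le (W : Fin n → Finset unitInterval) {N : ℕ}
    (hN : ∀ i, ((W i).card + s - 1).choose s ≤ N) :
    {θ : Thresholds n s | ∀ i j, θ.threshold i j ∈ W i}.encard ≤ ((N ^ n : ℕ) : ℕ∞) := by
  have threshold_injective : Function.Injective (Thresholds.threshold : Thresholds n s → _) :=
    fun _ _ => Thresholds.ext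
  rw [← threshold_injective.encard_image]
  calc _ ≤ (Set.pi Set.univ fun i => {f : Fin s → unitInterval |
          Monotone f ∧ ∀ j, f j ∈ W i}).encard := by
        refine Set.encard_le_encard ?_
        rintro _ ⟨θ, hθ, rfl⟩ i -
        exact ⟨θ.mono i, hθ i⟩
    _ = ∏ i, {f : Fin s → unitInterval | Monotone f ∧ ∀ j, f j ∈ W i}.encard :=
        Set.encard_pi_eq_prod_encard
    _ ≤ ∏ _i : Fin n, (N : ℕ∞) := Finset.prod_le_prod' fun i _ =>
        (encard_monotone_le (W i) s).trans (Nat.cast_le.2 (hN i))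
    _ = ((N ^ n : ℕ) : ℕ∞) := by simp

theorem encard_splitSample_le_choose (h : Sample n → Thresholds n s) (S : Sample n) :
    (splitSample h S).encard ≤ (S.card.choose ((S.card + 1) / 2) : ℕ) := by
  classical
  calc (splitSample h S).encard
      ≤ (h '' ((S.powersetCard ((S.card + 1) / 2)).toFinset : Set (Sample n))).encard := by
        refine Set.encard_le_encard ?_
        rintro θ ⟨T, hT, hc, rfl⟩
        exact ⟨T, by simp [Multiset.mem_powersetCard, hT, hc], rfl⟩
    _ ≤ _ := Set.encard_image_le _ _
    _ ≤ _ := by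
        rw [Set.encard_coe_eq_coe_finsetCard, ← Multiset.card_powersetCard]
        exact Nat.cast_le.2 (Multiset.toFinset_card_le _)

variable {h : Sample n → Thresholds n s}

theorem IsERM.encard_splitSample_le_pow_choose (hh : IsERM h) (S : Sample n) :
    (splitSample h S).encard ≤ (((S.card + s).choose s ^ n : ℕ) : ℕ∞) := by
  classical
  let W (i : Fin n) : Finset unitInterval := insert 1 (S.map fun v => v i).toFinset
  have card_W_le : ∀ i, (W i).card ≤ S.card + 1 := fun i =>
    (Finset.card_insert_le _ _).trans <| Nat.add_le_add_right
      ((Multiset.toFinset_card_le _).trans (Multiset.card_map _ _).le) 1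
  refine (Set.encard_le_encard ?_).trans (encard_thresholds_le W fun i =>
    Nat.choose_le_choose s (Nat.sub_le_of_le_add ((Nat.add_le_add_right (card_W_le i) s).trans
      (Nat.add_right_comm _ _ _).le)))
  rintro θ ⟨T, hT, -, rfl⟩ i j
  rcases hh.at_sample T i j with eq_one | ⟨v, hv, eq_value⟩
  · exact eq_one ▸ Finset.mem_insert_self _ _
  · exact eq_value ▸ Finset.mem_insert_of_mem (Multiset.mem_toFinset.2
      (Multiset.mem_map_of_mem (fun v => v i) (Multiset.mem_of_le hT hv)))

-- Counting thresholds needs four profiles; for smaller samples it suffices to count subsamples.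
theorem IsERM.growthRate_le (hh : IsERM h) (hn : 1 ≤ n) (hs : 2 ≤ s) {m : ℕ} (hm : 1 ≤ m) :
    growthRate h m ≤ ((m ^ (n * s) : ℕ) : ℕ∞) := by
  refine iSup_le ?_
  rintro ⟨S, rfl⟩
  rcases lt_or_ge S.card 4 with card_lt | le_card
  · refine (encard_splitSample_le_choose h S).trans (Nat.cast_le.2 ?_)
    calc S.card.choose ((S.card + 1) / 2) ≤ S.card := by interval_cases S.card <;> decide
      _ ≤ S.card ^ (n * s) := Nat.le_self_pow (by positivity) _
  · refine (hh.encard_splitSample_le_pow_choose S).trans (Nat.cast_le.2 ?_)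
    calc (S.card + s).choose s ^ n ≤ (S.card ^ s) ^ n :=
          Nat.pow_le_pow_left (choose_add_le_pow le_card hs) n
      _ = S.card ^ (n * s) := by rw [← pow_mul, mul_comm]

end GrowthRate

section Generalization

variable {n s m : ℕ} {h : Sample n → Thresholds n s}

theorem IsERM.sum_revenue_le (hh : IsERM h) (hm : 1 ≤ m) (θ : Thresholds n s)
    (z : Fin m → Profile n) :
    ∑ a, θ.auction.revenue (z a) ≤ ∑ a, (h (sampleOf z)).auction.revenue (z a) := by
  have average_le := hh.maximizes (sampleOf z) θ
  rw [empiricalRevenue_sampleOf, empiricalRevenue_sampleOf] at average_le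
  exact (div_le_div_iff_of_pos_right (Nat.cast_pos.2 hm)).1 average_le

theorem IsERM.expectedRevenue_sub_le (hh : IsERM h) (hm : 1 ≤ m) {K : ℕ}
    (hK : growthRate h (2 * m) ≤ K) (D : Fin n → Measure unitInterval)
    [∀ i, IsProbabilityMeasure (D i)] (θ : Thresholds n s) :
    expectedRevenue D θ.auction - Real.sqrt (2 * Real.log K / m)
      ≤ expectedLearnedRevenue D h m := by
  have : Nonempty (Fin m) := ⟨⟨0, hm⟩⟩
  have encard_image_le : ∀ S : Sample n, S.card = 2 * Fintype.card (Fin m) →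
      (h '' {T | T ≤ S ∧ T.card = Fintype.card (Fin m)}).encard ≤ K := fun S hS => by
    rw [Fintype.card_fin] at hS ⊢
    refine (Set.encard_le_encard ?_).trans ((le_iSup (fun S : {S : Sample n // S.card = 2 * m} =>
      (splitSample h S.1).encard) ⟨S, hS⟩).trans hK)
    rintro _ ⟨T, ⟨hTS, hT⟩, rfl⟩
    exact ⟨T, hTS, by simp only [hT, hS]; omega, rfl⟩
  have measurable_revenue : Measurable fun q : (Fin m → Profile n) × Profile n =>
      (h (drawnSample q.1)).auction.revenue q.2 :=
    Thresholds.measurable_revenue (fun i j => (hh.measurable m i j).comp measurable_fst)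
      measurable_snd
  have sub_sqrt_le := integral_sub_sqrt_le_of_maximizes (r := fun θ => θ.auction.revenue)
    (fun θ => θ.auction_isTruthful.revenue_mem_Icc) measurable_revenue encard_image_le
    θ.auction_isTruthful.measurable_revenue (hh.sum_revenue_le hm θ) (Measure.pi D)
  rwa [Fintype.card_fin] at sub_sqrt_le

theorem IsERM.levelOPT_sub_le (hh : IsERM h) (hn : 1 ≤ n) (hs : 2 ≤ s) (hm : 1 ≤ m)
    (D : Fin n → Measure unitInterval) [∀ i, IsProbabilityMeasure (D i)] :
    levelOPT s D - Real.sqrt (2 * (n : ℝ) * (s : ℝ) * Real.log (2 * (m : ℝ)) / (m : ℝ))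
      ≤ expectedLearnedRevenue D h m := by
  have log_growth : 2 * (n : ℝ) * s * Real.log (2 * m)
      = 2 * Real.log (((2 * m) ^ (n * s) : ℕ) : ℝ) := by
    push_cast
    rw [Real.log_pow]
    push_cast
    ring
  rw [sub_le_iff_le_add, log_growth]
  exact ciSup_le fun θ => sub_le_iff_le_add.1
    (hh.expectedRevenue_sub_le hm (hh.growthRate_le hn hs (by omega)) D θ)

end Generalization

/-! ### Price ladders -/

open Filter Topology

theorem upperSemicontinuous_mul_of_nonneg {X : Type*} [TopologicalSpace X] {f g : X → ℝ}
    (hf : UpperSemicontinuous f) (hg : UpperSemicontinuous g) (hf0 : ∀ x, 0 ≤ f x)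
    (hg0 : ∀ x, 0 ≤ g x) : UpperSemicontinuous fun x => f x * g x := by
  intro x y hy
  have tendsto_mul : Tendsto (fun δ : ℝ => (f x + δ) * (g x + δ)) (𝓝[>] 0) (𝓝 (f x * g x)) :=
    (Continuous.tendsto' (by fun_prop) 0 _ (by simp)).mono_left nhdsWithin_le_nhds
  obtain ⟨δ, hδy, hδ⟩ :=
    ((tendsto_mul.eventually (gt_mem_nhds hy)).and self_mem_nhdsWithin).exists
  filter_upwards [hf x _ (lt_add_of_pos_right _ hδ), hg x _ (lt_add_of_pos_right _ hδ)]
    with z hfz hgz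
  exact (mul_le_mul hfz.le hgz.le (hg0 z) ((hf0 z).trans hfz.le)).trans_lt hδy

theorem exists_greatest_argmax {α β : Type*} [LinearOrder α] [TopologicalSpace α]
    [OrderClosedTopology α] [CompactSpace α] [Nonempty α] [LinearOrder β] {f : α → β}
    (hf : UpperSemicontinuous f) : ∃ t, (∀ u, f u ≤ f t) ∧ ∀ u, t < u → f u < f t := by
  obtain ⟨t₀, -, ht₀⟩ := UpperSemicontinuousOn.exists_isMaxOn Set.univ_nonempty isCompact_univ
    (hf.upperSemicontinuousOn Set.univ)
  have le_max : ∀ u, f u ≤ f t₀ := fun u => ht₀ (Set.mem_univ u)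
  obtain ⟨t, ht, htop⟩ := (upperSemicontinuous_iff_isClosed_preimage.1 hf
    (f t₀)).isCompact.exists_isGreatest ⟨t₀, le_refl (f t₀)⟩
  have eq_max : f t = f t₀ := (le_max t).antisymm ht
  exact ⟨t, fun u => eq_max ▸ le_max u, fun u hu =>
    eq_max ▸ lt_of_not_ge fun h => hu.not_ge (htop h)⟩

/-- The probability that a bidder accepts the price `t`. -/
def demand (μ : Measure unitInterval) (t : unitInterval) : ℝ := μ.real (Set.Ici t)

section Demand

variable (μ : Measure unitInterval)

theorem demand_nonneg (t : unitInterval) : 0 ≤ demand μ t := measureReal_nonneg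

variable [IsFiniteMeasure μ]

theorem demand_antitone : Antitone (demand μ) := fun _ _ h =>
  measureReal_mono (Set.Ici_subset_Ici.2 h)

theorem tendsto_demand_of_monotone {u : ℕ → unitInterval} {t : unitInterval} (hu : Monotone u)
    (hut : ∀ k, u k ≤ t) (hlim : Tendsto u atTop (𝓝 t)) :
    Tendsto (fun k => demand μ (u k)) atTop (𝓝 (demand μ t)) := by
  have iInter_Ici : ⋂ k, Set.Ici (u k) = Set.Ici t := by
    ext x
    simp only [Set.mem_iInter, Set.mem_Ici]
    exact ⟨le_of_tendsto' hlim, fun h k => (hut k).trans h⟩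
  have tendsto_measure := tendsto_measure_iInter_atTop (μ := μ) (s := fun k => Set.Ici (u k))
    (fun k => measurableSet_Ici.nullMeasurableSet)
    (fun _ _ hkl => Set.Ici_subset_Ici.2 (hu hkl)) ⟨0, measure_ne_top _ _⟩
  rw [iInter_Ici] at tendsto_measure
  exact (ENNReal.tendsto_toReal (measure_ne_top _ _)).comp tendsto_measure

theorem upperSemicontinuous_demand : UpperSemicontinuous (demand μ) := by
  intro t y hy
  rcases (unitInterval.nonneg' (t := t)).eq_or_lt with rfl | zero_lt
  · exact Eventually.of_forall fun u => (demand_antitone μ unitInterval.nonneg').trans_lt hy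
  · obtain ⟨u, hu, hut, hlim⟩ := exists_seq_strictMono_tendsto' zero_lt
    obtain ⟨k, hk⟩ := ((tendsto_demand_of_monotone μ hu.monotone (fun k => (hut k).2.le)
      hlim).eventually (gt_mem_nhds hy)).exists
    filter_upwards [lt_mem_nhds (hut k).2] with x hx
    exact (demand_antitone μ hx.le).trans_lt hk

theorem exists_greatest_optimal_price {l : ℝ} (hl : l ≤ 1) :
    ∃ t : unitInterval, l ≤ t ∧
      (∀ u : unitInterval, ((u : ℝ) - l) * demand μ u ≤ (t - l) * demand μ t) ∧
      ∀ u : unitInterval, t < u → ((u : ℝ) - l) * demand μ u < (t - l) * demand μ t := by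
  let profit (t : unitInterval) : ℝ := max ((t : ℝ) - l) 0 * demand μ t
  have continuous_margin : Continuous fun t : unitInterval => max ((t : ℝ) - l) 0 := by fun_prop
  obtain ⟨t, ht, ht_greatest⟩ := exists_greatest_argmax <| upperSemicontinuous_mul_of_nonneg
    continuous_margin.upperSemicontinuous (upperSemicontinuous_demand μ)
    (fun _ => le_max_right _ _) (demand_nonneg μ)
  have cost_le : l ≤ t := by
    by_contra! lt_cost
    have profit_eq : profit t = 0 := by
      simp only [profit, max_eq_right (sub_nonpos.2 lt_cost.le), zero_mul]
    have profit_one_lt : profit 1 < profit t := ht_greatest 1 (lt_cost.trans_le hl)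
    exact (mul_nonneg (le_max_right _ _) (demand_nonneg μ 1)).not_gt (profit_eq ▸ profit_one_lt)
  have profit_eq : profit t = (t - l) * demand μ t := by
    simp only [profit, max_eq_left (sub_nonneg.2 cost_le)]
  have le_profit : ∀ u : unitInterval, ((u : ℝ) - l) * demand μ u ≤ profit u := fun u =>
    mul_le_mul_of_nonneg_right (le_max_left _ _) (demand_nonneg μ u)
  exact ⟨t, cost_le, fun u => (le_profit u).trans ((ht u).trans_eq profit_eq),
    fun u hu => (le_profit u).trans_lt ((ht_greatest u hu).trans_eq profit_eq)⟩

end Demand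

/-- Optimal posted prices for the opportunity costs `0, 1/s, 2/s, …, 1`. -/
structure IsPriceLadder (μ : Measure unitInterval) (s : ℕ) (τ : ℕ → unitInterval) : Prop where
  mono : Monotone τ
  optimal : ∀ k ≤ s, ∀ u : unitInterval,
    ((u : ℝ) - k / s) * demand μ u ≤ (τ k - k / s) * demand μ (τ k)
  top : τ s = 1

-- Taking the largest optimal price for every cost makes the prices increase with the cost.
theorem exists_isPriceLadder (μ : Measure unitInterval) [IsFiniteMeasure μ] {s : ℕ}
    (hs : 1 ≤ s) : ∃ τ, IsPriceLadder μ s τ := by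
  have s_pos : (0 : ℝ) < s := Nat.cast_pos.2 hs
  let cost (k : ℕ) : ℝ := min ((k : ℝ) / s) 1
  choose τ cost_le optimal greatest using fun k =>
    exists_greatest_optimal_price μ (l := cost k) (min_le_right _ _)
  refine ⟨τ, fun k k' hk => ?_, fun k hk u => ?_, ?_⟩
  · by_contra! prices_lt
    have cost_mono : cost k ≤ cost k' := min_le_min_right _ (by gcongr)
    have demand_le := demand_antitone μ prices_lt.le
    nlinarith [optimal k (τ k'), greatest k' (τ k) prices_lt]
  · have cost_eq : cost k = k / s := min_eq_left ((div_le_one s_pos).2 (by exact_mod_cast hk))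
    exact cost_eq ▸ optimal k u
  · have cost_eq : cost s = 1 := by simp [cost, s_pos.ne']
    exact unitInterval.le_one'.antisymm (Subtype.coe_le_coe.1 (cost_eq.symm.le.trans (cost_le s)))

/-- The profit at the `k`-th price of a ladder, when the item is worth `k / s` to the seller. -/
def ladderProfit (μ : Measure unitInterval) (s : ℕ) (τ : ℕ → unitInterval) (k : ℕ) : ℝ :=
  (τ k - k / s) * demand μ (τ k)

/-- The number of prices below a value in a price ladder, as a fraction of `s`; it plays the role
of the virtual value. -/
def ladderValue (s : ℕ) (τ : ℕ → unitInterval) (v : unitInterval) : ℝ :=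
  1 / s * ∑ k ∈ Finset.range s, (Set.Ici (τ k)).indicator 1 v

theorem measurable_ladderValue {s : ℕ} {τ : ℕ → unitInterval} : Measurable (ladderValue s τ) :=
  (Finset.measurable_sum _ fun _ _ => measurable_one.indicator measurableSet_Ici).const_mul _

theorem ladderValue_mem_Icc {s : ℕ} {τ : ℕ → unitInterval} (v : unitInterval) :
    ladderValue s τ v ∈ Set.Icc (0 : ℝ) 1 := by
  refine ⟨mul_nonneg (by positivity) (Finset.sum_nonneg fun _ _ =>
    Set.indicator_nonneg (fun _ _ => zero_le_one) _), ?_⟩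
  rw [ladderValue, one_div_mul_eq_div]
  refine div_le_one_of_le₀ ?_ (Nat.cast_nonneg _)
  simpa using Finset.sum_le_card_nsmul (Finset.range s)
    (fun k => (Set.Ici (τ k)).indicator (1 : unitInterval → ℝ) v) 1 fun k _ =>
      Set.indicator_le_self' (fun _ _ => zero_le_one) v

namespace IsPriceLadder

variable {μ : Measure unitInterval} {s : ℕ} {τ : ℕ → unitInterval}

theorem ladderProfit_top (hτ : IsPriceLadder μ s τ) (hs : 1 ≤ s) : ladderProfit μ s τ s = 0 := by
  have s_ne : (s : ℝ) ≠ 0 := Nat.cast_ne_zero.2 (Nat.one_le_iff_ne_zero.1 hs)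
  simp [ladderProfit, hτ.top, div_self s_ne]

theorem ladderProfit_le_succ (hτ : IsPriceLadder μ s τ) {k : ℕ} (hk : k < s) :
    ladderProfit μ s τ k ≤ ladderProfit μ s τ (k + 1) + 1 / s * demand μ (τ k) := by
  have optimal := hτ.optimal (k + 1) hk (τ k)
  unfold ladderProfit
  push_cast at optimal ⊢
  linear_combination optimal

theorem succ_le_ladderProfit (hτ : IsPriceLadder μ s τ) {k : ℕ} (hk : k < s) :
    ladderProfit μ s τ (k + 1) + 1 / s * demand μ (τ (k + 1)) ≤ ladderProfit μ s τ k := by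
  have optimal := hτ.optimal k hk.le (τ (k + 1))
  unfold ladderProfit
  push_cast at optimal ⊢
  linear_combination optimal

theorem ladderProfit_le (hτ : IsPriceLadder μ s τ) (hs : 1 ≤ s) {j : ℕ} (hj : j ≤ s) :
    ladderProfit μ s τ j ≤ 1 / s * ∑ k ∈ Finset.Ico j s, demand μ (τ k) := by
  induction hj using Nat.decreasingInduction with
  | self => simp [hτ.ladderProfit_top hs]
  | of_succ k hk ih =>
    rw [Finset.sum_eq_sum_Ico_succ_bot hk, mul_add]
    linarith [hτ.ladderProfit_le_succ hk]

theorem le_ladderProfit (hτ : IsPriceLadder μ s τ) (hs : 1 ≤ s) {j : ℕ} (hj : j ≤ s) :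
    1 / s * ∑ k ∈ Finset.Ico (j + 1) (s + 1), demand μ (τ k) ≤ ladderProfit μ s τ j := by
  induction hj using Nat.decreasingInduction with
  | self => simp [hτ.ladderProfit_top hs]
  | of_succ k hk ih =>
    rw [Finset.sum_eq_sum_Ico_succ_bot (Nat.succ_lt_succ hk), mul_add]
    linarith [hτ.succ_le_ladderProfit hk]

theorem mul_demand_le_sum (hτ : IsPriceLadder μ s τ) (hs : 1 ≤ s) (t : unitInterval) :
    t * demand μ t ≤ 1 / s * ∑ k ∈ Finset.range s, demand μ (max (τ k) t) := by
  classical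
  have le_top : t ≤ τ s := hτ.top ▸ unitInterval.le_one'
  have exists_le : ∃ k, t ≤ τ k := ⟨s, le_top⟩
  set j := Nat.find exists_le
  have j_le : j ≤ s := Nat.find_min' exists_le le_top
  have demand_low : ∀ k ∈ Finset.range j, demand μ (max (τ k) t) = demand μ t := fun k hk => by
    rw [max_eq_right (not_le.1 (Nat.find_min exists_le (Finset.mem_range.1 hk))).le]
  have demand_high : ∀ k ∈ Finset.Ico j s, demand μ (max (τ k) t) = demand μ (τ k) :=
    fun k hk => by
      rw [max_eq_left ((Nat.find_spec exists_le).trans (hτ.mono (Finset.mem_Ico.1 hk).1))]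
  rw [← Finset.sum_range_add_sum_Ico _ j_le, Finset.sum_congr rfl demand_low,
    Finset.sum_congr rfl demand_high, Finset.sum_const, Finset.card_range, nsmul_eq_mul]
  have profit_le : ((τ j : ℝ) - j / s) * demand μ (τ j)
      ≤ 1 / s * ∑ k ∈ Finset.Ico j s, demand μ (τ k) := hτ.ladderProfit_le hs j_le
  linear_combination hτ.optimal j j_le t + profit_le

theorem mul_measureReal_Ici_le_setIntegral [IsFiniteMeasure μ] (hτ : IsPriceLadder μ s τ)
    (hs : 1 ≤ s) (t : unitInterval) :
    t * μ.real (Set.Ici t) ≤ ∫ v in Set.Ici t, ladderValue s τ v ∂μ := by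
  refine (hτ.mul_demand_le_sum hs t).trans_eq ?_
  have integrable_indicator : ∀ k, Integrable ((Set.Ici (τ k)).indicator (1 : unitInterval → ℝ))
      (μ.restrict (Set.Ici t)) := fun k => (integrable_const (1 : ℝ)).indicator measurableSet_Ici
  unfold ladderValue
  rw [integral_const_mul, integral_finsetSum _ fun k _ => integrable_indicator k]
  refine congrArg _ (Finset.sum_congr rfl fun k _ => ?_)
  rw [integral_indicator_one measurableSet_Ici, measureReal_restrict_apply measurableSet_Ici,
    Set.Ici_inter_Ici]
  rfl

end IsPriceLadder

/-! ### Truthful mechanisms for a single bidder -/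

theorem exists_seq_tendsto_measureReal_Ici {α : Type*} [CompleteLinearOrder α]
    [TopologicalSpace α] [OrderTopology α] [FirstCountableTopology α] [MeasurableSpace α]
    (μ : Measure α) [IsFiniteMeasure μ] {U : Set α} (hU : IsUpperSet U) (hne : U.Nonempty) :
    ∃ u : ℕ → α, (∀ k, u k ∈ U) ∧
      Tendsto (fun k => μ.real (Set.Ici (u k))) atTop (𝓝 (μ.real U)) := by
  by_cases inf_mem : sInf U ∈ U
  · have Ici_eq : Set.Ici (sInf U) = U :=
      Set.Subset.antisymm (fun x hx => hU hx inf_mem) fun x hx => sInf_le hx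
    refine ⟨fun _ => sInf U, fun _ => inf_mem, ?_⟩
    simp only [Ici_eq]
    exact tendsto_const_nhds
  · obtain ⟨u, u_anti, hlim, u_mem⟩ := exists_seq_tendsto_sInf hne (OrderBot.bddBelow U)
    have iUnion_Ici : ⋃ k, Set.Ici (u k) = U := by
      refine (Set.iUnion_subset fun k x hx => hU hx (u_mem k)).antisymm fun x hx => ?_
      have inf_lt : sInf U < x := (sInf_le hx).lt_of_ne fun h => inf_mem (h ▸ hx)
      obtain ⟨k, hk⟩ := (hlim.eventually (gt_mem_nhds inf_lt)).exists
      exact Set.mem_iUnion.2 ⟨k, hk.le⟩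
    have tendsto_measure := tendsto_measure_iUnion_atTop (μ := μ) (s := fun k => Set.Ici (u k))
      fun _ _ hkl => Set.Ici_subset_Ici.2 (u_anti hkl)
    rw [iUnion_Ici] at tendsto_measure
    exact ⟨u, u_mem, (ENNReal.tendsto_toReal (measure_ne_top _ _)).comp tendsto_measure⟩

theorem sInf_mul_measureReal_le_setIntegral {μ : Measure unitInterval} [IsFiniteMeasure μ]
    {w : unitInterval → ℝ} (hw : Integrable w μ) (hw0 : ∀ v, 0 ≤ w v)
    (h : ∀ t : unitInterval, t * μ.real (Set.Ici t) ≤ ∫ v in Set.Ici t, w v ∂μ)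
    {U : Set unitInterval} (hU : IsUpperSet U) :
    (sInf U : unitInterval) * μ.real U ≤ ∫ v in U, w v ∂μ := by
  rcases U.eq_empty_or_nonempty with rfl | hne
  · simp
  obtain ⟨u, u_mem, hlim⟩ := exists_seq_tendsto_measureReal_Ici μ hU hne
  refine le_of_tendsto' (hlim.const_mul _) fun k => ?_
  calc ((sInf U : unitInterval) : ℝ) * μ.real (Set.Ici (u k))
      ≤ u k * μ.real (Set.Ici (u k)) :=
        mul_le_mul_of_nonneg_right (sInf_le (u_mem k)) measureReal_nonneg
    _ ≤ ∫ v in Set.Ici (u k), w v ∂μ := h (u k)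
    _ ≤ ∫ v in U, w v ∂μ := setIntegral_mono_set hw.integrableOn
        (Eventually.of_forall hw0) (Eventually.of_forall fun x hx => hU hx (u_mem k))

/-- A truthful mechanism for a single bidder, who wins with probability `x b` and pays `p b` when
bidding `b`. -/
structure IsTruthfulMechanism (x p : unitInterval → ℝ) : Prop where
  truthful : ∀ v b : unitInterval, (v : ℝ) * x b - p b ≤ v * x v - p v
  individually_rational : ∀ v : unitInterval, 0 ≤ (v : ℝ) * x v - p v

/-- The bids that win with probability at least `c`. -/
def winningBids (x : unitInterval → ℝ) (c : ℝ) : Set unitInterval := {v | c ≤ x v}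

theorem sum_indicator_winningBids {x : unitInterval → ℝ} {δ : ℝ} (hδ : 0 ≤ δ) {k : ℕ}
    {v : unitInterval} (hv : k * δ ≤ x v) (f : ℕ → unitInterval → ℝ) :
    ∑ j ∈ Finset.range k, (winningBids x ((j + 1) * δ)).indicator (f j) v
      = ∑ j ∈ Finset.range k, f j v := by
  refine Finset.sum_congr rfl fun j hj => Set.indicator_of_mem ?_ _
  have succ_le : (j + 1 : ℝ) ≤ k := by exact_mod_cast Finset.mem_range.1 hj
  exact (mul_le_mul_of_nonneg_right succ_le hδ).trans hv

theorem one_div_mul_sum_indicator_winningBids {x : unitInterval → ℝ} {v : unitInterval}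
    (hv : x v ∈ Set.Icc (0 : ℝ) 1) {N : ℕ} (hN : 0 < N) :
    1 / N * ∑ j ∈ Finset.range N,
        (winningBids x ((j + 1) * (1 / N))).indicator (1 : unitInterval → ℝ) v
      = ⌊N * x v⌋₊ / N := by
  have N_pos : (0 : ℝ) < N := Nat.cast_pos.2 hN
  have filter_eq : (Finset.range N).filter (fun j : ℕ => ((j : ℝ) + 1) * (1 / N) ≤ x v)
      = Finset.range ⌊N * x v⌋₊ := by
    ext j
    rw [Finset.mem_filter, Finset.mem_range, Finset.mem_range, ← Nat.succ_le_iff (n := ⌊_⌋₊),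
      Nat.le_floor_iff (mul_nonneg N_pos.le hv.1), mul_one_div, div_le_iff₀ N_pos,
      mul_comm (x v), Nat.cast_succ, and_iff_right_iff_imp]
    intro succ_le
    have : (j + 1 : ℝ) ≤ N := succ_le.trans (mul_le_of_le_one_right N_pos.le hv.2)
    exact_mod_cast this
  have indicator_eq : ∀ j : ℕ,
      (winningBids x ((j + 1) * (1 / N))).indicator (1 : unitInterval → ℝ) v
      = if ((j : ℝ) + 1) * (1 / N) ≤ x v then 1 else 0 := fun j => by
    simp only [Set.indicator_apply, winningBids, Set.mem_ofPred_eq, Pi.one_apply]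
  simp only [indicator_eq, Finset.sum_boole, filter_eq, Finset.card_range]
  exact one_div_mul_eq_div _ _

theorem one_div_mul_sum_indicator_winningBids_le {x w : unitInterval → ℝ} {v : unitInterval}
    (hx : x v ∈ Set.Icc (0 : ℝ) 1) (hw : 0 ≤ w v) {N : ℕ} (hN : 0 < N) :
    1 / N * ∑ j ∈ Finset.range N, (winningBids x ((j + 1) * (1 / N))).indicator w v
      ≤ w v * x v := by
  have floor_le : (⌊N * x v⌋₊ : ℝ) / N ≤ x v :=
    div_le_of_le_mul₀ (Nat.cast_nonneg _) hx.1
      ((Nat.floor_le (mul_nonneg (Nat.cast_nonneg _) hx.1)).trans_eq (mul_comm _ _))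
  refine le_trans (le_of_eq ?_) (mul_le_mul_of_nonneg_left floor_le hw)
  rw [← one_div_mul_sum_indicator_winningBids hx hN, mul_left_comm, Finset.mul_sum _ _ (w v)]
  simp only [← Set.indicator_mul_right, Pi.one_apply, mul_one]

namespace IsTruthfulMechanism

variable {x p : unitInterval → ℝ}

theorem alloc_monotone (h : IsTruthfulMechanism x p) : Monotone x := by
  intro v b hvb
  rcases hvb.eq_or_lt with rfl | hlt
  · exact le_rfl
  · have coe_lt : (v : ℝ) < b := hlt
    by_contra! alloc_lt
    nlinarith [h.truthful v b, h.truthful b v]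

theorem isUpperSet_winningBids (h : IsTruthfulMechanism x p) (c : ℝ) :
    IsUpperSet (winningBids x c) :=
  fun _ _ hab ha => le_trans ha (h.alloc_monotone hab)

-- The slope of the utility is at least `(k + 1) * δ` from the first bid that wins with this
-- probability.
theorem sum_indicator_le_utility (h : IsTruthfulMechanism x p) {δ : ℝ} (hδ : 0 ≤ δ) (k : ℕ)
    (v : unitInterval) :
    δ * ∑ j ∈ Finset.range k, (winningBids x ((j + 1) * δ)).indicator
        (fun v => (v : ℝ) - (sInf (winningBids x ((j + 1) * δ)) : unitInterval)) v
      ≤ v * x v - p v := by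
  induction k generalizing v with
  | zero => simpa using h.individually_rational v
  | succ k ih =>
    rw [Finset.sum_range_succ, mul_add]
    by_cases hv : v ∈ winningBids x ((k + 1) * δ)
    swap
    · rw [Set.indicator_of_notMem hv, mul_zero, add_zero]
      exact ih v
    rw [Set.indicator_of_mem hv]
    set S : unitInterval → ℝ := fun v => ∑ j ∈ Finset.range k,
      (winningBids x ((j + 1) * δ)).indicator
        (fun v => (v : ℝ) - (sInf (winningBids x ((j + 1) * δ)) : unitInterval)) v with S_def
    have S_sub : ∀ u ∈ winningBids x ((k + 1) * δ), S v - S u = k * (v - u) := fun u hu => by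
      have le_alloc : ∀ {b}, b ∈ winningBids x ((k + 1) * δ) → k * δ ≤ x b := fun hb =>
        le_trans (mul_le_mul_of_nonneg_right (le_add_of_nonneg_right zero_le_one) hδ) hb
      simp only [S_def]
      rw [sum_indicator_winningBids hδ (le_alloc hv), sum_indicator_winningBids hδ (le_alloc hu),
        ← Finset.sum_sub_distrib]
      simp [mul_sub]
    have winningBids_subset : winningBids x ((k + 1) * δ)
        ⊆ {u | δ * S v + δ * ((v : ℝ) - u) ≤ v * x v - p v} := fun u hu => by
      rw [Set.mem_ofPred_eq]
      rcases le_total v u with huv | huv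
      · have : δ * ((v : ℝ) - u) ≤ 0 := mul_nonpos_of_nonneg_of_nonpos hδ (sub_nonpos.2 huv)
        linarith [ih v]
      · have : ((v : ℝ) - u) * ((k + 1) * δ) ≤ (v - u) * x u :=
          mul_le_mul_of_nonneg_left hu (sub_nonneg.2 huv)
        linear_combination h.truthful v u + ih u + this + δ * S_sub u hu
    exact closure_minimal winningBids_subset (isClosed_le (by fun_prop) continuous_const)
      (csInf_mem_closure ⟨v, hv⟩ (OrderBot.bddBelow _))

theorem pay_le_sum_indicator (h : IsTruthfulMechanism x p) {v : unitInterval}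
    (hv : x v ∈ Set.Icc (0 : ℝ) 1) {N : ℕ} (hN : 0 < N) :
    p v ≤ 1 / N + 1 / N * ∑ j ∈ Finset.range N, (winningBids x ((j + 1) * (1 / N))).indicator
      (fun _ => ((sInf (winningBids x ((j + 1) * (1 / N))) : unitInterval) : ℝ)) v := by
  have N_pos : (0 : ℝ) < N := Nat.cast_pos.2 hN
  have utility_ge := h.sum_indicator_le_utility (δ := 1 / N) (by positivity) N v
  have sum_sub : ∀ q : ℕ → ℝ,
      ∑ j ∈ Finset.range N, (winningBids x ((j + 1) * (1 / N))).indicator (fun v => (v : ℝ) - q j) v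
      = v * ∑ j ∈ Finset.range N, (winningBids x ((j + 1) * (1 / N))).indicator 1 v
        - ∑ j ∈ Finset.range N, (winningBids x ((j + 1) * (1 / N))).indicator (fun _ => q j) v :=
    fun q => by
      rw [Finset.mul_sum, ← Finset.sum_sub_distrib]
      refine Finset.sum_congr rfl fun j _ => ?_
      by_cases hj : v ∈ winningBids x ((j + 1) * (1 / N))
      · simp only [Set.indicator_of_mem hj, Pi.one_apply, mul_one]
      · simp only [Set.indicator_of_notMem hj, mul_zero, sub_zero]
  have floor_gap : x v - ⌊N * x v⌋₊ / N ≤ 1 / N := by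
    rw [sub_le_iff_le_add, ← add_div, le_div_iff₀ N_pos, mul_comm, add_comm]
    exact (Nat.lt_floor_add_one _).le
  have value_mul_gap : v * (x v - ⌊N * x v⌋₊ / N) ≤ 1 / N :=
    (mul_le_mul_of_nonneg_left floor_gap (unitInterval.nonneg v)).trans
      (mul_le_of_le_one_left (by positivity) (unitInterval.le_one v))
  rw [sum_sub] at utility_ge
  linear_combination utility_ge + value_mul_gap
    - v * one_div_mul_sum_indicator_winningBids hv hN

variable {μ : Measure unitInterval} [IsProbabilityMeasure μ] {w : unitInterval → ℝ}

theorem integral_pay_le_one_div_add (h : IsTruthfulMechanism x p) (hx : ∀ v, x v ∈ Set.Icc 0 1)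
    (hp : Integrable p μ) (hw : Integrable w μ) (hw0 : ∀ v, 0 ≤ w v)
    (hprice : ∀ t : unitInterval, t * μ.real (Set.Ici t) ≤ ∫ v in Set.Ici t, w v ∂μ)
    {N : ℕ} (hN : 0 < N) : ∫ v, p v ∂μ ≤ 1 / N + ∫ v, w v * x v ∂μ := by
  let U (j : ℕ) : Set unitInterval := winningBids x ((j + 1) * (1 / N))
  have measurable_x : Measurable x := h.alloc_monotone.measurable
  have measurableSet_U : ∀ j, MeasurableSet (U j) := fun j =>
    measurableSet_le measurable_const measurable_x
  have integrable_wx : Integrable (fun v => w v * x v) μ :=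
    hw.mul_bdd (c := 1) measurable_x.aestronglyMeasurable
      (.of_forall fun v => by simpa [abs_of_nonneg (hx v).1] using (hx v).2)
  have integrable_indicator : ∀ (f : ℕ → unitInterval → ℝ), (∀ j, Integrable (f j) μ) →
      ∀ j ∈ Finset.range N, Integrable ((U j).indicator (f j)) μ := fun f hf j _ =>
    (hf j).indicator (measurableSet_U j)
  calc ∫ v, p v ∂μ
      ≤ ∫ v, (1 / N + 1 / N * ∑ j ∈ Finset.range N,
          (U j).indicator (fun _ => ((sInf (U j) : unitInterval) : ℝ)) v) ∂μ :=
        integral_mono hp ((integrable_const _).add ((integrable_finsetSum _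
          (integrable_indicator _ fun _ => integrable_const _)).const_mul _))
          fun v => h.pay_le_sum_indicator (hx v) hN
    _ = 1 / N + 1 / N * ∑ j ∈ Finset.range N, (sInf (U j) : unitInterval) * μ.real (U j) := by
        rw [integral_add (integrable_const _) ((integrable_finsetSum _
          (integrable_indicator _ fun _ => integrable_const _)).const_mul _), integral_const_mul,
          integral_finsetSum _ (integrable_indicator _ fun _ => integrable_const _)]
        simp [integral_indicator_const _ (measurableSet_U _), mul_comm]
    _ ≤ 1 / N + 1 / N * ∑ j ∈ Finset.range N, ∫ v in U j, w v ∂μ := by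
        gcongr with j _
        exact sInf_mul_measureReal_le_setIntegral hw hw0 hprice (h.isUpperSet_winningBids _)
    _ = 1 / N + ∫ v, 1 / N * ∑ j ∈ Finset.range N, (U j).indicator w v ∂μ := by
        rw [integral_const_mul, integral_finsetSum _ (integrable_indicator _ fun _ => hw)]
        simp only [integral_indicator (measurableSet_U _)]
    _ ≤ 1 / N + ∫ v, w v * x v ∂μ := by
        refine add_le_add le_rfl (integral_mono ((integrable_finsetSum _
          (integrable_indicator _ fun _ => hw)).const_mul _) integrable_wx fun v => ?_)
        exact one_div_mul_sum_indicator_winningBids_le (hx v) (hw0 v) hN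

-- It suffices to bound the revenue of posted prices, because a truthful mechanism is a lottery
-- over posted prices.
theorem integral_pay_le (h : IsTruthfulMechanism x p) (hx : ∀ v, x v ∈ Set.Icc 0 1)
    (hp : Integrable p μ) (hw : Integrable w μ) (hw0 : ∀ v, 0 ≤ w v)
    (hprice : ∀ t : unitInterval, t * μ.real (Set.Ici t) ≤ ∫ v in Set.Ici t, w v ∂μ) :
    ∫ v, p v ∂μ ≤ ∫ v, w v * x v ∂μ := by
  have tendsto_bound := (tendsto_one_div_add_atTop_nhds_zero_nat (𝕜 := ℝ)).add_const
    (∫ v, w v * x v ∂μ)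
  rw [zero_add] at tendsto_bound
  refine ge_of_tendsto' tendsto_bound fun N => ?_
  simpa using h.integral_pay_le_one_div_add hx hp hw hw0 hprice N.succ_pos

end IsTruthfulMechanism

/-! ### Redrawing a single value -/

section Redraw

variable {ι : Type*} [Fintype ι] [DecidableEq ι] {X : ι → Type*} [∀ j, MeasurableSpace (X j)]
  (μ : ∀ j, Measure (X j)) [∀ j, SigmaFinite (μ j)] (i : ι) [IsProbabilityMeasure (μ i)]

theorem measurePreserving_update :
    MeasurePreserving (fun q : (∀ j, X j) × X i => Function.update q.1 i q.2)
      ((Measure.pi μ).prod (μ i)) (Measure.pi μ) := by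
  refine ⟨measurable_update', (Measure.pi_eq fun S hS => ?_).symm⟩
  have preimage_pi : (fun q : (∀ j, X j) × X i => Function.update q.1 i q.2) ⁻¹' Set.univ.pi S
      = Set.univ.pi (Function.update S i Set.univ) ×ˢ S i := by
    ext ⟨v, b⟩
    simp only [Set.mem_preimage, Set.mem_univ_pi, Set.mem_prod]
    rw [Function.forall_update_iff v fun j a => a ∈ S j,
      Function.forall_update_iff S fun j U => v j ∈ U, and_comm]
    simp only [Set.mem_univ, true_and]
  rw [Measure.map_apply measurable_update' (.univ_pi hS), preimage_pi, Measure.prod_prod,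
    Measure.pi_pi, Fintype.prod_eq_mul_prod_compl i, Fintype.prod_eq_mul_prod_compl i,
    Function.update_self, measure_univ, one_mul, mul_comm]
  congr 1
  refine Finset.prod_congr rfl fun j hj => ?_
  rw [Function.update_of_ne (by simpa using hj)]

theorem integral_le_integral_of_update {f g : (∀ j, X j) → ℝ} (hf : Integrable f (Measure.pi μ))
    (hg : Integrable g (Measure.pi μ))
    (h : ∀ v, ∫ b, f (Function.update v i b) ∂(μ i) ≤ ∫ b, g (Function.update v i b) ∂(μ i)) :
    ∫ v, f v ∂(Measure.pi μ) ≤ ∫ v, g v ∂(Measure.pi μ) := by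
  have preserving := measurePreserving_update μ i
  have integrable_f : Integrable (fun q : (∀ j, X j) × X i => f (Function.update q.1 i q.2))
      ((Measure.pi μ).prod (μ i)) := preserving.integrable_comp_of_integrable hf
  have integrable_g : Integrable (fun q : (∀ j, X j) × X i => g (Function.update q.1 i q.2))
      ((Measure.pi μ).prod (μ i)) := preserving.integrable_comp_of_integrable hg
  rw [← integral_comp_measurePreserving preserving hf.aestronglyMeasurable,
    ← integral_comp_measurePreserving preserving hg.aestronglyMeasurable,
    integral_prod _ integrable_f, integral_prod _ integrable_g]
  exact integral_mono integrable_f.integral_prod_left integrable_g.integral_prod_left h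

end Redraw

/-! ### Truthful auctions against level auctions -/

namespace Auction.IsTruthful

variable {n : ℕ} {A : Auction n}

theorem isTruthfulMechanism (hA : A.IsTruthful) (v : Profile n) (i : Fin n) :
    IsTruthfulMechanism (fun b => A.alloc (Function.update v i b) i)
      fun b => A.pay (Function.update v i b) i where
  truthful a b := by simpa using hA.truthful (Function.update v i a) i b
  individually_rational b := by simpa using hA.individually_rational (Function.update v i b) i

theorem integrable_ladderValue_mul_alloc (hA : A.IsTruthful) {P : Measure (Profile n)}
    [IsFiniteMeasure P] {s : ℕ} {τ : ℕ → unitInterval} (i : Fin n) :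
    Integrable (fun v => ladderValue s τ (v i) * A.alloc v i) P :=
  (hA.integrable_alloc i).bdd_mul (c := 1)
    (measurable_ladderValue.comp (measurable_pi_apply i)).aestronglyMeasurable
    (.of_forall fun v => by
      simpa [abs_of_nonneg (ladderValue_mem_Icc (v i)).1] using (ladderValue_mem_Icc (v i)).2)

theorem integral_pay_le (hA : A.IsTruthful) {D : Fin n → Measure unitInterval}
    [∀ i, IsProbabilityMeasure (D i)] {s : ℕ} (hs : 1 ≤ s) {i : Fin n} {τ : ℕ → unitInterval}
    (hτ : IsPriceLadder (D i) s τ) :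
    ∫ v, A.pay v i ∂(Measure.pi D)
      ≤ ∫ v, ladderValue s τ (v i) * A.alloc v i ∂(Measure.pi D) := by
  refine integral_le_integral_of_update D i (hA.integrable_pay i)
    (hA.integrable_ladderValue_mul_alloc i) fun v => ?_
  simp only [Function.update_self]
  exact (hA.isTruthfulMechanism v i).integral_pay_le
    (fun b => ⟨hA.alloc_nonneg _ i, hA.alloc_le_one _ i⟩)
    (.of_mem_Icc (-1) 1 ((hA.measurable_pay i).comp (measurable_update v)).aemeasurable
      (.of_forall fun b => hA.pay_mem_Icc _ i))
    (.of_mem_Icc 0 1 measurable_ladderValue.aemeasurable (.of_forall ladderValue_mem_Icc))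
    (fun b => (ladderValue_mem_Icc b).1) (hτ.mul_measureReal_Ici_le_setIntegral hs)

end Auction.IsTruthful

namespace Thresholds

variable {n s : ℕ}

theorem Wins.index_le {θ : Thresholds n s} {v : Profile n} {i : Fin n} (h : θ.Wins v i)
    (k : Fin n) : θ.index k (v k) ≤ θ.index i (v i) := by
  rcases eq_or_ne k i with rfl | hk
  · exact le_rfl
  · exact (h.2 k hk).elim le_of_lt fun tie => tie.1.le

theorem exists_wins (θ : Thresholds n s) (v : Profile n) {i : Fin n}
    (hi : 0 < θ.index i (v i)) : ∃ k, θ.Wins v k := by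
  obtain ⟨k, -, hk⟩ := Finset.exists_max_image Finset.univ
    (fun l => toLex (θ.index l (v l), OrderDual.toDual l)) ⟨i, Finset.mem_univ i⟩
  have lex_le : ∀ l, θ.index l (v l) < θ.index k (v k) ∨
      θ.index l (v l) = θ.index k (v k) ∧ k ≤ l := fun l =>
    Prod.Lex.toLex_le_toLex.1 (hk l (Finset.mem_univ l))
  refine ⟨k, hi.trans_le ((lex_le i).elim le_of_lt fun tie => tie.1.le), fun l hl => ?_⟩
  exact (lex_le l).imp_right fun tie => ⟨tie.1, tie.2.lt_of_ne hl.symm⟩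

/-- The value of a winner of index `j`, rounded down to the grid point `(j - 1) / s`. A loser
counts as `0`. -/
def wonLevel (θ : Thresholds n s) (v : Profile n) (i : Fin n) : ℝ :=
  ((θ.index i (v i) : ℝ) - 1) / s * θ.auction.alloc v i

theorem wonLevel_mem_Icc (θ : Thresholds n s) (v : Profile n) (i : Fin n) :
    θ.wonLevel v i ∈ Set.Icc (0 : ℝ) 1 := by
  rw [wonLevel, auction_alloc]
  split_ifs with hwin
  · have one_le : (1 : ℝ) ≤ θ.index i (v i) := by
      exact_mod_cast (winLevel_pos i _).trans_le hwin
    have le_succ : (θ.index i (v i) : ℝ) ≤ s + 1 := by exact_mod_cast θ.index_le i (v i)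
    rw [mul_one]
    exact ⟨div_nonneg (sub_nonneg.2 one_le) s.cast_nonneg,
      div_le_one_of_le₀ (sub_le_iff_le_add.2 le_succ) s.cast_nonneg⟩
  · simp

theorem integrable_wonLevel (θ : Thresholds n s) {P : Measure (Profile n)} [IsFiniteMeasure P]
    (i : Fin n) : Integrable (fun v => θ.wonLevel v i) P := by
  have measurable_index : Measurable fun v : Profile n => (θ.index i (v i) : ℝ) :=
    (measurable_of_countable (fun k : ℕ => (k : ℝ))).comp
      (measurable_index (fun _ _ => measurable_const) measurable_id i)
  exact .of_mem_Icc 0 1 (((measurable_index.sub_const 1).div_const _).mul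
    (θ.auction_isTruthful.measurable_alloc i)).aemeasurable
    (.of_forall fun v => θ.wonLevel_mem_Icc v i)

end Thresholds

section LadderThresholds

variable {n s : ℕ} {D : Fin n → Measure unitInterval} {τ : Fin n → ℕ → unitInterval}

/-- The thresholds of the level auction that uses the prices of a ladder for every bidder. As
ladders count from `0`, the price `τ i k` is the threshold `θ_{k+1}`. -/
def ladderThresholds (hτ : ∀ i, IsPriceLadder (D i) s (τ i)) : Thresholds n s where
  threshold i j := τ i j
  mono i _ _ hjk := (hτ i).mono hjk

variable (hτ : ∀ i, IsPriceLadder (D i) s (τ i))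

theorem fullThreshold_ladderThresholds {i : Fin n} {k : ℕ} (hk : k ≤ s) :
    (ladderThresholds hτ).fullThreshold i (k + 1) = τ i k := by
  rcases hk.eq_or_lt with rfl | hlt
  · rw [Thresholds.fullThreshold_of_lt _ _ (Nat.lt_succ_self _), (hτ i).top]
  · exact Thresholds.fullThreshold_succ _ i ⟨k, hlt⟩

theorem lt_index_ladderThresholds_iff {i : Fin n} {k : ℕ} (hk : k ≤ s) (b : unitInterval) :
    k < (ladderThresholds hτ).index i b ↔ τ i k ≤ b := by
  rw [← fullThreshold_ladderThresholds hτ hk,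
    ← Thresholds.le_index_iff _ _ _ (Nat.succ_le_succ hk), Nat.succ_le_iff]

theorem indicator_Ici_ladder {i : Fin n} {k : ℕ} (hk : k ≤ s) (b : unitInterval) :
    (Set.Ici (τ i k)).indicator (1 : unitInterval → ℝ) b
      = if k < (ladderThresholds hτ).index i b then 1 else 0 := by
  classical
  rw [Set.indicator_apply]
  simp only [lt_index_ladderThresholds_iff hτ hk, Set.mem_Ici, Pi.one_apply]

theorem ladderValue_le_index {i : Fin n} (b : unitInterval) :
    ladderValue s (τ i) b ≤ (ladderThresholds hτ).index i b / s := by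
  rw [ladderValue, one_div_mul_eq_div]
  refine div_le_div_of_nonneg_right ?_ (Nat.cast_nonneg _)
  rw [Finset.sum_congr rfl fun k hk => indicator_Ici_ladder hτ (Finset.mem_range.1 hk).le b,
    Finset.sum_boole, Nat.cast_le]
  have filter_subset : ((Finset.range s).filter (· < (ladderThresholds hτ).index i b))
      ⊆ Finset.range ((ladderThresholds hτ).index i b) := fun k hk =>
    Finset.mem_range.2 (Finset.mem_filter.1 hk).2
  simpa using Finset.card_le_card filter_subset

theorem card_filter_Ico_lt {j m : ℕ} (hm : m ≤ s + 1) :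
    ((Finset.Ico (j + 1) (s + 1)).filter (· < m)).card = m - (j + 1) := by
  have filter_eq : (Finset.Ico (j + 1) (s + 1)).filter (· < m) = Finset.Ico (j + 1) m := by
    ext k
    simp only [Finset.mem_filter, Finset.mem_Ico]
    omega
  rw [filter_eq, Nat.card_Ico]

theorem wonLevel_update {v : Profile n} {i : Fin n} {j : ℕ} (hj : j ≤ s)
    (hwin : Thresholds.winLevel i ((ladderThresholds hτ).indices v) = j + 1) (b : unitInterval) :
    (ladderThresholds hτ).wonLevel (Function.update v i b) i
      = j / s * (Set.Ici (τ i j)).indicator (1 : unitInterval → ℝ) b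
        + 1 / s * ∑ k ∈ Finset.Ico (j + 1) (s + 1),
          (Set.Ici (τ i k)).indicator (1 : unitInterval → ℝ) b := by
  rw [Thresholds.wonLevel, Thresholds.auction_alloc, Thresholds.winLevel_indices_update, hwin,
    Function.update_self, indicator_Ici_ladder hτ hj, Finset.sum_congr rfl fun k hk =>
      indicator_Ici_ladder hτ (Nat.lt_succ_iff.1 (Finset.mem_Ico.1 hk).2) b,
    Finset.sum_boole, card_filter_Ico_lt ((ladderThresholds hτ).index_le i b)]
  simp only [Nat.succ_le_iff]
  split_ifs with hlt
  · rw [Nat.cast_sub hlt]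
    push_cast
    ring
  · rw [Nat.sub_eq_zero_of_le (Nat.le_succ_of_le (not_lt.1 hlt))]
    simp

theorem pay_ladderThresholds_update {v : Profile n} {i : Fin n} {j : ℕ} (hj : j ≤ s)
    (hwin : Thresholds.winLevel i ((ladderThresholds hτ).indices v) = j + 1) (b : unitInterval) :
    (ladderThresholds hτ).auction.pay (Function.update v i b) i
      = τ i j * (Set.Ici (τ i j)).indicator (1 : unitInterval → ℝ) b := by
  rw [Thresholds.auction_pay, Thresholds.winLevel_indices_update, hwin, Function.update_self,
    indicator_Ici_ladder hτ hj, fullThreshold_ladderThresholds hτ hj]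
  simp only [Nat.succ_le_iff, mul_ite, mul_one, mul_zero]

theorem IsPriceLadder.integral_level_le {μ : Measure unitInterval} [IsFiniteMeasure μ]
    {σ : ℕ → unitInterval} (hσ : IsPriceLadder μ s σ) (hs : 1 ≤ s) {j : ℕ} (hj : j ≤ s) :
    ∫ b, (j / s * (Set.Ici (σ j)).indicator (1 : unitInterval → ℝ) b
        + 1 / s * ∑ k ∈ Finset.Ico (j + 1) (s + 1), (Set.Ici (σ k)).indicator 1 b) ∂μ
      ≤ ∫ b, σ j * (Set.Ici (σ j)).indicator (1 : unitInterval → ℝ) b ∂μ := by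
  have integrable_indicator : ∀ k,
      Integrable ((Set.Ici (σ k)).indicator (1 : unitInterval → ℝ)) μ := fun k =>
    (integrable_const (1 : ℝ)).indicator measurableSet_Ici
  have integral_indicator : ∀ k, ∫ b, (Set.Ici (σ k)).indicator (1 : unitInterval → ℝ) b ∂μ
      = demand μ (σ k) := fun k => integral_indicator_one measurableSet_Ici
  rw [integral_add ((integrable_indicator j).const_mul _)
    ((integrable_finsetSum _ fun k _ => integrable_indicator k).const_mul _), integral_const_mul,
    integral_const_mul, integral_const_mul, integral_finsetSum _ fun k _ => integrable_indicator k]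
  simp only [integral_indicator]
  have le_profit := hσ.le_ladderProfit hs hj
  unfold ladderProfit at le_profit
  linear_combination le_profit

theorem integral_wonLevel_le_integral_pay [∀ i, IsProbabilityMeasure (D i)] (hs : 1 ≤ s)
    (i : Fin n) :
    ∫ v, (ladderThresholds hτ).wonLevel v i ∂(Measure.pi D)
      ≤ ∫ v, (ladderThresholds hτ).auction.pay v i ∂(Measure.pi D) := by
  refine integral_le_integral_of_update D i ((ladderThresholds hτ).integrable_wonLevel i)
    ((ladderThresholds hτ).auction_isTruthful.integrable_pay i) fun v => ?_
  obtain ⟨j, hwin⟩ : ∃ j, Thresholds.winLevel i ((ladderThresholds hτ).indices v) = j + 1 :=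
    Nat.exists_eq_succ_of_ne_zero (Thresholds.winLevel_pos i _).ne'
  rcases le_or_gt j s with hj | hj
  · simp only [wonLevel_update hτ hj hwin, pay_ladderThresholds_update hτ hj hwin]
    exact (hτ i).integral_level_le hs hj
  · have never_wins : ∀ b, ¬ j + 1 ≤ (ladderThresholds hτ).index i b := fun b hb => by
      have := (ladderThresholds hτ).index_le i b
      omega
    simp [Thresholds.wonLevel, Thresholds.auction_alloc, Thresholds.auction_pay,
      Thresholds.winLevel_indices_update, hwin, never_wins]

theorem sum_ladderValue_mul_alloc_le_div {A : Auction n} (hA : A.IsTruthful) {v : Profile n}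
    {M : ℕ} (hM : ∀ i, (ladderThresholds hτ).index i (v i) ≤ M) :
    ∑ i, ladderValue s (τ i) (v i) * A.alloc v i ≤ M / s :=
  calc ∑ i, ladderValue s (τ i) (v i) * A.alloc v i
      ≤ ∑ i, (M : ℝ) / s * A.alloc v i := by
        refine Finset.sum_le_sum fun i _ => mul_le_mul_of_nonneg_right
          ((ladderValue_le_index hτ (v i)).trans ?_) (hA.alloc_nonneg v i)
        gcongr
        exact hM i
    _ = M / s * ∑ i, A.alloc v i := (Finset.mul_sum ..).symm
    _ ≤ M / s := mul_le_of_le_one_right (by positivity) (hA.alloc_sum_le_one v)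

theorem sum_ladderValue_mul_alloc_le {A : Auction n} (hA : A.IsTruthful) (v : Profile n) :
    ∑ i, ladderValue s (τ i) (v i) * A.alloc v i
      ≤ 1 / s + ∑ i, (ladderThresholds hτ).wonLevel v i := by
  set θ := ladderThresholds hτ
  have wonLevel_nonneg : ∀ i ∈ Finset.univ, 0 ≤ θ.wonLevel v i := fun i _ =>
    (θ.wonLevel_mem_Icc v i).1
  by_cases sold : ∃ k, θ.Wins v k
  · obtain ⟨k, hk⟩ := sold
    calc ∑ i, ladderValue s (τ i) (v i) * A.alloc v i
        ≤ θ.index k (v k) / s := sum_ladderValue_mul_alloc_le_div hτ hA hk.index_le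
      _ = 1 / s + θ.wonLevel v k := by
          rw [Thresholds.wonLevel, Thresholds.auction_alloc, if_pos ((θ.wins_iff v k).1 hk)]
          ring
      _ ≤ 1 / s + ∑ i, θ.wonLevel v i :=
          add_le_add le_rfl (Finset.single_le_sum wonLevel_nonneg (Finset.mem_univ k))
  · have index_le_zero : ∀ i, θ.index i (v i) ≤ 0 := fun i =>
      not_lt.1 fun hi => sold (θ.exists_wins v hi)
    refine (sum_ladderValue_mul_alloc_le_div hτ hA index_le_zero).trans ?_
    rw [Nat.cast_zero, zero_div]
    exact add_nonneg (by positivity) (Finset.sum_nonneg wonLevel_nonneg)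

theorem expectedRevenue_le_ladderThresholds [∀ i, IsProbabilityMeasure (D i)] (hs : 1 ≤ s)
    {A : Auction n} (hA : A.IsTruthful) :
    expectedRevenue D A ≤ 1 / s + expectedRevenue D (ladderThresholds hτ).auction := by
  set θ := ladderThresholds hτ
  have integrable_sum : Integrable (fun v => ∑ i, θ.wonLevel v i) (Measure.pi D) :=
    integrable_finsetSum _ fun i _ => θ.integrable_wonLevel i
  rw [hA.expectedRevenue_eq_sum D, θ.auction_isTruthful.expectedRevenue_eq_sum D]
  calc ∑ i, ∫ v, A.pay v i ∂(Measure.pi D)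
      ≤ ∑ i, ∫ v, ladderValue s (τ i) (v i) * A.alloc v i ∂(Measure.pi D) :=
        Finset.sum_le_sum fun i _ => hA.integral_pay_le hs (hτ i)
    _ = ∫ v, ∑ i, ladderValue s (τ i) (v i) * A.alloc v i ∂(Measure.pi D) :=
        (integral_finsetSum _ fun i _ => hA.integrable_ladderValue_mul_alloc i).symm
    _ ≤ ∫ v, (1 / s + ∑ i, θ.wonLevel v i) ∂(Measure.pi D) :=
        integral_mono (integrable_finsetSum _ fun i _ => hA.integrable_ladderValue_mul_alloc i)
          ((integrable_const _).add integrable_sum) (sum_ladderValue_mul_alloc_le hτ hA)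
    _ = 1 / s + ∑ i, ∫ v, θ.wonLevel v i ∂(Measure.pi D) := by
        rw [integral_add (integrable_const _) integrable_sum,
          integral_finsetSum _ fun i _ => θ.integrable_wonLevel i]
        simp
    _ ≤ 1 / s + ∑ i, ∫ v, θ.auction.pay v i ∂(Measure.pi D) :=
        add_le_add le_rfl (Finset.sum_le_sum fun i _ =>
          integral_wonLevel_le_integral_pay hτ hs i)

end LadderThresholds

theorem OPT_sub_le_levelOPT {n s : ℕ} (hs : 1 ≤ s) (D : Fin n → Measure unitInterval)
    [∀ i, IsProbabilityMeasure (D i)] :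
    OPT D - 1 / (s : ℝ) ≤ levelOPT s D := by
  choose τ hτ using fun i => exists_isPriceLadder (D i) hs
  rw [sub_le_iff_le_add']
  exact ciSup_le fun A => (expectedRevenue_le_ladderThresholds hτ hs A.2).trans
    (add_le_add le_rfl (expectedRevenue_le_levelOPT D _))

/-! ### Sample complexity -/

section GridWidth

variable {n m : ℕ}

theorem log_two_mul_natCast_pos (hm : 1 ≤ m) : 0 < Real.log (2 * (m : ℝ)) := by
  have : (1 : ℝ) ≤ m := by exact_mod_cast hm
  exact Real.log_pos (by linarith)

theorem gridWidth_pos (hn : 1 ≤ n) (hm : 1 ≤ m) : 0 < gridWidth n m := by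
  have log_pos := log_two_mul_natCast_pos hm
  exact Real.rpow_pos_of_pos (by positivity) _

theorem gridWidth_pow_three (n : ℕ) (hm : 1 ≤ m) :
    gridWidth n m ^ 3 = 2 * (n : ℝ) * Real.log (2 * (m : ℝ)) / (m : ℝ) := by
  have log_pos := log_two_mul_natCast_pos hm
  rw [gridWidth, ← Real.rpow_natCast, ← Real.rpow_mul (by positivity)]
  norm_num

theorem one_div_add_sqrt_le {e s : ℝ} (he : 0 < e) (he1 : e ≤ 1 / 2) (hle : 1 / e ≤ s)
    (hge : s ≤ 1 / e + 1) : 1 / s + Real.sqrt (s * e ^ 3) ≤ 2 * e := by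
  have one_le_mul : 1 ≤ s * e := by rwa [div_le_iff₀ he] at hle
  have mul_le_two : s * e ≤ 2 := by
    have : s * e ≤ (1 / e + 1) * e := by gcongr
    rw [add_mul, one_div_mul_cancel he.ne'] at this
    linarith
  have s_pos : 0 < s := (one_div_pos.2 he).trans_le hle
  set y := Real.sqrt (s * e)
  have y_sq : y ^ 2 = s * e := Real.sq_sqrt (by linarith)
  have one_le_y : 1 ≤ y := Real.one_le_sqrt.2 one_le_mul
  have y_le : y ≤ 3 / 2 := by nlinarith
  have sqrt_eq : Real.sqrt (s * e ^ 3) = e * y := by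
    rw [show s * e ^ 3 = e ^ 2 * (s * e) by ring, Real.sqrt_mul (by positivity),
      Real.sqrt_sq he.le]
  have one_div_eq : 1 / s = e * (1 / y ^ 2) := by
    rw [y_sq]
    field_simp
  have le_two : 1 / y ^ 2 + y ≤ 2 := by
    rw [← le_sub_iff_add_le, div_le_iff₀ (by positivity)]
    nlinarith [mul_nonneg (sub_nonneg.2 one_le_y) (show 0 ≤ 1 + y - y ^ 2 by nlinarith [y_le])]
  rw [sqrt_eq, one_div_eq, ← mul_add, mul_comm 2 e]
  gcongr

theorem IsERM.OPT_sub_le (hn : 1 ≤ n) (hm : 1 ≤ m)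
    {h : Sample n → Thresholds n (levels n m)} (hh : IsERM h) (D : Fin n → Measure unitInterval)
    [∀ i, IsProbabilityMeasure (D i)] :
    OPT D - 2 * gridWidth n m ≤ expectedLearnedRevenue D h m := by
  have width_pos := gridWidth_pos hn hm
  rcases le_or_gt (gridWidth n m) (1 / 2) with width_le | width_gt
  · have le_levels : 1 / gridWidth n m ≤ levels n m := Nat.le_ceil _
    have levels_le : (levels n m : ℝ) ≤ 1 / gridWidth n m + 1 :=
      (Nat.ceil_lt_add_one (by positivity)).le
    have two_le_levels : 2 ≤ levels n m := by
      have : (2 : ℝ) ≤ 1 / gridWidth n m := by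
        rw [le_div_iff₀ width_pos]
        linarith
      exact_mod_cast this.trans le_levels
    have estimation_error := hh.levelOPT_sub_le hn two_le_levels hm D
    have approximation_error := OPT_sub_le_levelOPT (one_le_two.trans two_le_levels) D
    have total_error := one_div_add_sqrt_le width_pos width_le le_levels levels_le
    rw [gridWidth_pow_three n hm, ← mul_div_assoc, ← mul_assoc, mul_left_comm, ← mul_assoc,
      mul_right_comm (2 : ℝ)] at total_error
    linarith
  · have learned_nonneg : 0 ≤ expectedLearnedRevenue D h m := integral_nonneg fun z =>
      ((h (sampleOf z)).auction_isTruthful.expectedRevenue_mem_Icc D).1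
    linarith [OPT_le_one D]

end GridWidth

theorem log_le_div_add_log {x a : ℝ} (hx : 0 < x) (ha : 0 < a) :
    Real.log x ≤ x / a + Real.log a := by
  have tangent := Real.log_le_sub_one_of_pos (div_pos hx ha)
  rw [Real.log_div hx.ne' ha.ne'] at tangent
  linarith

section SampleBound

variable {n : ℕ} {ε : ℝ}

theorem log_two_le_log_div (hn : 1 ≤ n) (hε : 0 < ε) (hε1 : ε ≤ 1 / 2) :
    Real.log 2 ≤ Real.log (n / ε) := by
  have one_le : (1 : ℝ) ≤ n := by exact_mod_cast hn
  refine Real.log_le_log two_pos ?_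
  rw [le_div_iff₀ hε]
  linarith

theorem log_mul_div_pow_three_le (hn : 1 ≤ n) (hε : 0 < ε) (hε1 : ε ≤ 1 / 2) :
    Real.log (64 * n / ε ^ 3) ≤ 9 * Real.log (n / ε) := by
  have one_le : (1 : ℝ) ≤ n := by exact_mod_cast hn
  have le_mul_pow : 64 * (n : ℝ) / ε ^ 3 ≤ 2 ^ 6 * (n / ε) ^ 3 := by
    rw [div_pow, ← mul_div_assoc]
    gcongr
    · norm_num
    · exact le_self_pow₀ one_le three_ne_zero
  have log_le := Real.log_le_log (by positivity) le_mul_pow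
  rw [Real.log_mul (by norm_num) (by positivity), Real.log_pow, Real.log_pow] at log_le
  push_cast at log_le
  linarith [log_two_le_log_div hn hε hε1]

-- The tangent of the logarithm at `64 * n / ε ^ 3` uses up one half of the right-hand side.
theorem sixteen_mul_log_le (hn : 1 ≤ n) (hε : 0 < ε) (hε1 : ε ≤ 1 / 2) {m : ℝ} (hm0 : 0 < m)
    (hm : 288 * (n * Real.log (n / ε) / ε ^ 3) ≤ m) :
    16 * n * Real.log (2 * m) ≤ m * ε ^ 3 := by
  have sample_bound : 288 * (n * Real.log (n / ε)) ≤ m * ε ^ 3 := by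
    rwa [← mul_div_assoc, div_le_iff₀ (by positivity)] at hm
  calc 16 * n * Real.log (2 * m)
      ≤ 16 * n * (2 * m / (64 * n / ε ^ 3) + 9 * Real.log (n / ε)) := by
        gcongr
        exact (log_le_div_add_log (by positivity) (by positivity)).trans
          (add_le_add le_rfl (log_mul_div_pow_three_le hn hε hε1))
    _ = m * ε ^ 3 / 2 + 144 * (n * Real.log (n / ε)) := by
        field_simp
        ring
    _ ≤ m * ε ^ 3 := by linarith

theorem two_mul_gridWidth_le {m : ℕ} (hn : 1 ≤ n) (hm1 : 1 ≤ m) (hε : 0 < ε)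
    (hε1 : ε ≤ 1 / 2) (hm : 288 * (n * Real.log (n / ε) / ε ^ 3) ≤ m) :
    2 * gridWidth n m ≤ ε := by
  have m_pos : (0 : ℝ) < m := by exact_mod_cast hm1
  refine le_of_pow_le_pow_left₀ three_ne_zero hε.le ?_
  rw [mul_pow, gridWidth_pow_three n hm1, ← mul_div_assoc, div_le_iff₀ m_pos]
  linarith [sixteen_mul_log_le hn hε hε1 m_pos hm]

theorem one_le_mul_log_div (hn : 1 ≤ n) (hε : 0 < ε) (hε1 : ε ≤ 1 / 2) :
    1 ≤ n * Real.log (n / ε) / ε ^ 3 := by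
  have one_le : (1 : ℝ) ≤ n := by exact_mod_cast hn
  have cube_le : ε ^ 3 ≤ (1 / 2) ^ 3 := by gcongr
  rw [le_div_iff₀ (by positivity)]
  nlinarith [log_two_le_log_div hn hε hε1, Real.log_two_gt_d9]

theorem mul_log_div_le (hn : 1 ≤ n) (hε : 0 < ε) (hεn : ε ≤ 1 / (n : ℝ)) :
    n * Real.log (n / ε) / ε ^ 3 ≤ 2 * (n * Real.log (1 / ε) / ε ^ 3) := by
  have n_pos : (0 : ℝ) < n := by exact_mod_cast hn
  have log_le : Real.log (n / ε) ≤ 2 * Real.log (1 / ε) := by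
    have div_le : (n : ℝ) / ε ≤ (1 / ε) ^ 2 := by
      rw [sq, div_eq_mul_one_div (n : ℝ)]
      gcongr
      exact (le_one_div hε n_pos).1 hεn
    simpa using Real.log_le_log (by positivity) div_le
  calc n * Real.log (n / ε) / ε ^ 3 ≤ n * (2 * Real.log (1 / ε)) / ε ^ 3 := by gcongr
    _ = 2 * (n * Real.log (1 / ε) / ε ^ 3) := by ring

theorem exists_isLeast_accurateFrom (hn : 1 ≤ n) {h : ∀ s : ℕ, Sample n → Thresholds n s}
    (hh : ∀ s, IsERM (h s)) (hε : 0 < ε) (hε1 : ε ≤ 1 / 2) :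
    ∃ k : ℕ, IsLeast (accurateFrom h ε) k ∧
      (k : ℝ) ≤ 289 * ((n : ℝ) * Real.log ((n : ℝ) / ε) / ε ^ 3) := by
  classical
  have one_le_bound := one_le_mul_log_div hn hε hε1
  set B := (n : ℝ) * Real.log ((n : ℝ) / ε) / ε ^ 3
  have accurate : ⌈288 * B⌉₊ ∈ accurateFrom h ε := by
    intro m hm D hD
    have bound_le : 288 * B ≤ m := Nat.ceil_le.1 hm
    have one_le_m : 1 ≤ m := by
      have : (1 : ℝ) ≤ m := by linarith
      exact_mod_cast this
    linarith [(hh (levels n m)).OPT_sub_le hn one_le_m D,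
      two_mul_gridWidth_le hn one_le_m hε hε1 bound_le]
  refine ⟨sInf (accurateFrom h ε), ⟨Nat.sInf_mem ⟨_, accurate⟩, fun k => Nat.sInf_le⟩, ?_⟩
  calc ((sInf (accurateFrom h ε) : ℕ) : ℝ) ≤ ⌈288 * B⌉₊ := Nat.cast_le.2 (Nat.sInf_le accurate)
    _ ≤ 288 * B + 1 := (Nat.ceil_lt_add_one (by linarith)).le
    _ ≤ 289 * B := by linarith

end SampleBound

end LevelAuctions

end

theorem mainTheorem5 :
    -- level auctions are dominant strategy truthful
    (∀ (n s : ℕ) (θ : LevelAuctions.Thresholds n s), θ.auction.IsTruthful) ∧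
    -- empirical revenue can be maximized with thresholds at sample values
    (∀ n s : ℕ, ∃ h : LevelAuctions.Sample n → LevelAuctions.Thresholds n s,
      LevelAuctions.IsERM h) ∧
    -- split-sample growth rate, and the resulting bound against the best level auction
    (∀ n s : ℕ, 1 ≤ n → 2 ≤ s →
      ∀ h : LevelAuctions.Sample n → LevelAuctions.Thresholds n s, LevelAuctions.IsERM h →
      ∀ m : ℕ, 1 ≤ m →
        LevelAuctions.growthRate h m ≤ ((m ^ (n * s) : ℕ) : ℕ∞) ∧
        ∀ D : Fin n → MeasureTheory.Measure unitInterval,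
          (∀ i, MeasureTheory.IsProbabilityMeasure (D i)) →
          LevelAuctions.levelOPT s D
              - Real.sqrt (2 * (n : ℝ) * (s : ℝ) * Real.log (2 * (m : ℝ)) / (m : ℝ))
            ≤ LevelAuctions.expectedLearnedRevenue D h m) ∧
    -- level auctions with grid width `1 / s` are optimal up to `1 / s`
    (∀ n s : ℕ, 1 ≤ n → 1 ≤ s → ∀ D : Fin n → MeasureTheory.Measure unitInterval,
      (∀ i, MeasureTheory.IsProbabilityMeasure (D i)) →
      LevelAuctions.OPT D - 1 / (s : ℝ) ≤ LevelAuctions.levelOPT s D) ∧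
    -- the error bound against the optimal auction
    (∀ n : ℕ, 1 ≤ n → ∀ m : ℕ, 1 ≤ m →
      ∀ h : LevelAuctions.Sample n → LevelAuctions.Thresholds n (LevelAuctions.levels n m),
      LevelAuctions.IsERM h →
      ∀ D : Fin n → MeasureTheory.Measure unitInterval,
        (∀ i, MeasureTheory.IsProbabilityMeasure (D i)) →
        LevelAuctions.OPT D
            - 2 * (2 * (n : ℝ) * Real.log (2 * (m : ℝ)) / (m : ℝ)) ^ (1 / 3 : ℝ)
          ≤ LevelAuctions.expectedLearnedRevenue D h m) ∧
    -- the sample complexity, with a universal constant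
    (∃ C : ℝ, 0 < C ∧ ∀ n : ℕ, 1 ≤ n →
      ∀ h : ∀ s : ℕ, LevelAuctions.Sample n → LevelAuctions.Thresholds n s,
      (∀ s, LevelAuctions.IsERM (h s)) →
      ∀ ε : ℝ, 0 < ε → ε ≤ 1 / 2 →
        ∃ k : ℕ, IsLeast (LevelAuctions.accurateFrom h ε) k ∧
          (k : ℝ) ≤ C * ((n : ℝ) * Real.log ((n : ℝ) / ε) / ε ^ 3) ∧
          (ε ≤ 1 / (n : ℝ) → (k : ℝ) ≤ C * ((n : ℝ) * Real.log (1 / ε) / ε ^ 3))) := by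
  refine ⟨fun n s θ => θ.auction_isTruthful, LevelAuctions.exists_isERM, ?_, ?_, ?_, ?_⟩
  · intro n s hn hs h hh m hm
    exact ⟨hh.growthRate_le hn hs hm, fun D hD => hh.levelOPT_sub_le hn hs hm D⟩
  · intro n s _ hs D hD
    exact LevelAuctions.OPT_sub_le_levelOPT hs D
  · intro n hn m hm h hh D hD
    exact hh.OPT_sub_le hn hm D
  · refine ⟨578, by norm_num, fun n hn h hh ε hε hε1 => ?_⟩
    obtain ⟨k, isLeast, k_le⟩ := LevelAuctions.exists_isLeast_accurateFrom hn hh hε hε1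
    have one_le_bound := LevelAuctions.one_le_mul_log_div hn hε hε1
    exact ⟨k, isLeast, by linarith, fun hεn => by linarith [LevelAuctions.mul_log_div_le hn hε hεn]⟩
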